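/- **Theorem (Simulation error; product training, global cost).** Let $n,\kappa,K,M\ge 0$ and $N\ge 1$ be integers, $d=2^n$, let $H$ be a Hermitian operator on $n$ qubits, $\Delta t\in\mathbb{R}$, and let $U=U_{\Delta t}$ be an $n$-qubit unitary; put $\epsilon=\lVert U_{\Delta t}-e^{-iH\Delta t}\rVert_2$ (Schatten $2$-norm). Let $V_t(\vec\alpha)=W(\vec\alpha)D_t(\vec\alpha)W(\vec\alpha)^\dagger$ be a parameterized family of unitaries, with $\vec\alpha$ in an arbitrary parameter set, $W(\vec\alpha)$ unitary and $D_t(\vec\alpha)=\sum_{x}e^{-itE_x(\vec\alpha)}|x\rangle\langle x|$ diagonal in the computational basis with $E_x(\vec\alpha)\in\mathbb{R}$ (so that $V_{M\Delta t}=V_{\Delta t}^M$). Suppose that $V_{\Delta t}(\vec\alpha)$ is a quantum neural network of fixed architecture, that is, a circuit that consists of $K$ parameterized unitary gates, each acting on at most $\kappa$ qubits, and of an arbitrary number of non-trainable, possibly global, unitaries. The training data are $\mathcal{D}_{\rm P}(N)=\{(|\Psi^{(j)}\rangle,U|\Psi^{(j)}\rangle)\}_{j=1}^N$ with $|\Psi^{(j)}\rangle=\bigotimes_{i=1}^n|\psi_i^{(j)}\rangle$,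 where the $|\psi_i^{(j)}\rangle$ are i.i.d. Haar-random single-qubit states. Let $\vec\alpha_{\rm opt}=\vec\alpha_{\rm opt}(\mathcal{D}_{\rm P}(N))$ be the output of an arbitrary training procedure, and let $$C^{G}_{\mathcal{D}_{\rm P}(N)}(\vec\alpha)=\frac1N\sum_{j=1}^N\operatorname{Tr}\!\left[V_{\Delta t}(\vec\alpha)^\dagger\,U|\Psi^{(j)}\rangle\langle\Psi^{(j)}|U^\dagger\,V_{\Delta t}(\vec\alpha)\left(\mathbb{1}-|\Psi^{(j)}\rangle\langle\Psi^{(j)}|\right)\right]$$ be the global training cost. Let $0<\delta\le 1$, and $\delta\le 1/2$ if $K=1$; read $0\log 0$ as $0$. Then, with probability at least $1-\delta$ over the training data, $$\overline F(\vec\alpha_{\rm opt},M\Delta t)\ \ge\ 1-2M^2\left[\frac{\epsilon^2}{d+1}+4\,C^{G}_{\mathcal{D}_{\rm P}(N)}(\vec\alpha_{\rm opt})\right]-C\,M^2\left(\sqrt{\frac{K\log K}{N}}+\sqrt{\frac{\log(1/\delta)}{N}}\right),$$ where $\overline F(\vec\alpha,T)=\mathbb{E}_{|\Psi\rangle\sim{\rm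 Haar}_n}\big[|\langle\Psi|(e^{-iHT})^\dagger V_T(\vec\alpha)|\Psi\rangle|^2\big]$ is the average fidelity over Haar-random $n$-qubit states, and the constant $C>0$ depends only on the locality $\kappa$. -/

import Mathlib

open MeasureTheory

universe u

noncomputable section

namespace FastForward

/-! ### States, Haar-random states -/

/-- Labels of the computational basis of `n` qubits (so the dimension is `d = 2 ^ n`). -/
abbrev Basis (n : ℕ) : Type := Fin n → Fin 2

/-- Operators on `n` qubits. -/
abbrev Op (n : ℕ) : Type := Matrix (Basis n) (Basis n) ℂ

/-- Vectors of `n` qubits, in coordinates with respect to the computational basis. -/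
abbrev Vec (n : ℕ) : Type := Basis n → ℂ

section Haar

variable (ι : Type) [Fintype ι] [DecidableEq ι]

instance : MeasurableSpace (Matrix.unitaryGroup ι ℂ) := borel _

instance : BorelSpace (Matrix.unitaryGroup ι ℂ) := ⟨rfl⟩

instance : CompactSpace (Matrix.unitaryGroup ι ℂ) := by
  have hcl : IsClosed ((Matrix.unitaryGroup ι ℂ : Submonoid (Matrix ι ι ℂ)) :
      Set (Matrix ι ι ℂ)) := isClosed_unitary
  have hK : IsCompact (Set.univ.pi fun _ : ι => Set.univ.pi fun _ : ι =>
      Metric.closedBall (0 : ℂ) 1) :=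
    isCompact_univ_pi fun _ => isCompact_univ_pi fun _ => isCompact_closedBall _ _
  refine isCompact_iff_compactSpace.mp (IsCompact.of_isClosed_subset hK hcl ?_)
  intro A hA i _ j _
  simpa using entry_norm_bound_of_unitary hA i j

/-- The Haar probability measure on the unitary group. -/
def haarUnitary : Measure (Matrix.unitaryGroup ι ℂ) := Measure.haarMeasure ⊤

instance : IsProbabilityMeasure (haarUnitary ι) := by
  refine ⟨?_⟩
  have h := Measure.haarMeasure_self (K₀ := (⊤ : TopologicalSpace.PositiveCompacts
    (Matrix.unitaryGroup ι ℂ)))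
  simpa [haarUnitary] using h

variable {ι}

/-- The law of a Haar-random pure state: the law of `U |i₀⟩` with `U` a Haar-random unitary
(it does not depend on the choice of the basis vector `|i₀⟩`). -/
def haarState (i₀ : ι) : Measure (ι → ℂ) :=
  (haarUnitary ι).map fun U : Matrix.unitaryGroup ι ℂ => (U : Matrix ι ι ℂ).mulVec (Pi.single i₀ 1)

theorem measurable_haarState_map (i₀ : ι) :
    Measurable fun U : Matrix.unitaryGroup ι ℂ =>
      (U : Matrix ι ι ℂ).mulVec (Pi.single i₀ (1 : ℂ)) :=
  (Continuous.matrix_mulVec continuous_subtype_val continuous_const).measurable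

instance (i₀ : ι) : IsProbabilityMeasure (haarState i₀) :=
  Measure.isProbabilityMeasure_map (measurable_haarState_map i₀).aemeasurable

end Haar

/-- The tensor product `⨂ᵢ |ψᵢ⟩` of single-qubit vectors. -/
def productState {n : ℕ} (ψ : Fin n → Fin 2 → ℂ) : Vec n := fun x => ∏ i, ψ i (x i)

/-- The law of `N` independent families of `n` independent Haar-random single-qubit states. -/
def productInputLaw (N n : ℕ) : Measure (Fin N → Fin n → Fin 2 → ℂ) :=
  Measure.pi fun _ => Measure.pi fun _ => haarState (0 : Fin 2)

/-- Training data: `N` pairs of an input state and an output state. -/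
abbrev Dataset (N n : ℕ) : Type := Fin N → Vec n × Vec n

/-- The training data with product inputs and with outputs generated by `U`. -/
def productDataset {N n : ℕ} (U : Op n) (ψ : Fin N → Fin n → Fin 2 → ℂ) : Dataset N n :=
  fun j => (productState (ψ j), U.mulVec (productState (ψ j)))

/-! ### Costs and fidelities -/

/-- The rank-one operator `|v⟩⟨v|`. -/
def ketbra {n : ℕ} (v : Vec n) : Op n := Matrix.vecMulVec v (star v)

/-- The global loss `Tr[V† |Φ⟩⟨Φ| V (1 - |Ψ⟩⟨Ψ|)]`. -/
def globalLoss {n : ℕ} (V : Op n) (Ψ Φ : Vec n) : ℝ :=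
  (V.conjTranspose * ketbra Φ * V * (1 - ketbra Ψ)).trace.re

/-- The global training cost: the average of the global loss over the data. -/
def globalCost {N n : ℕ} (𝒟 : Dataset N n) (V : Op n) : ℝ :=
  (1 / (N : ℝ)) * ∑ j, globalLoss V (𝒟 j).1 (𝒟 j).2

/-- The average over Haar-random `n`-qubit states `Ψ` of the fidelity `|⟨Ψ| U† V |Ψ⟩|²`. -/
def averageFidelity {n : ℕ} (U V : Op n) : ℝ :=
  ∫ Ψ : Vec n, ‖star Ψ ⬝ᵥ (U.conjTranspose * V).mulVec Ψ‖ ^ 2 ∂(haarState (0 : Basis n))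

/-- The exact evolution `e^{-iHt}`. -/
def evolution {n : ℕ} (H : Op n) (t : ℝ) : Op n :=
  NormedSpace.exp ((-(Complex.I * (t : ℂ))) • H)

/-- The Schatten 2-norm `√(Tr[A† A])`. -/
def schattenTwoNorm {n : ℕ} (A : Op n) : ℝ := √((A.conjTranspose * A).trace.re)

/-! ### Circuits with parameterized local gates -/

/-- A layer of a unitary circuit with parameter space `Θ`: a non-trainable `n`-qubit unitary, or a
parameterized gate that acts on a set `S` of qubits (and trivially on the others). -/
inductive Layer (n : ℕ) (Θ : Type u) : Type u
  | fixed (U : Matrix.unitaryGroup (Basis n) ℂ) : Layer n Θ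
  | gate (S : Finset (Fin n)) (g : Θ → Matrix.unitaryGroup (S → Fin 2) ℂ) : Layer n Θ

/-- The operator `g ⊗ 1` on `n` qubits, where `g` acts on the qubits in `S`. -/
def extend {n : ℕ} (S : Finset (Fin n)) (g : Matrix (S → Fin 2) (S → Fin 2) ℂ) : Op n :=
  fun x y => if ∀ i, i ∉ S → x i = y i then g (fun i => x i) (fun i => y i) else 0

/-- A circuit of fixed architecture: a list of layers, the last of which acts first. -/
abbrev Circuit (n : ℕ) (Θ : Type u) : Type u := List (Layer n Θ)

namespace Layer

variable {n : ℕ} {Θ : Type u}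

/-- The operator implemented by a layer at the parameter setting `α`. -/
def toOp : Layer n Θ → Θ → Op n
  | fixed U, _ => (U : Op n)
  | gate S g, α => extend S (g α : Matrix (S → Fin 2) (S → Fin 2) ℂ)

/-- `1` for a parameterized gate, `0` for a non-trainable unitary. -/
def count : Layer n Θ → ℕ
  | fixed _ => 0
  | gate _ _ => 1

/-- A parameterized gate acts on at most `κ` qubits; a non-trainable unitary may be global. -/
def IsLocal (κ : ℕ) : Layer n Θ → Prop
  | fixed _ => True
  | gate S _ => S.card ≤ κ

end Layer

namespace Circuit

variable {n : ℕ} {Θ : Type u}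

/-- The unitary implemented by the circuit at the parameter setting `α`. -/
def toOp (Q : Circuit n Θ) (α : Θ) : Op n := (Q.map fun l => l.toOp α).prod

/-- The number of parameterized gates. -/
def gateCount (Q : Circuit n Θ) : ℕ := (Q.map Layer.count).sum

/-- All parameterized gates act on at most `κ` qubits. -/
def IsLocal (κ : ℕ) (Q : Circuit n Θ) : Prop := ∀ l ∈ Q, l.IsLocal κ

end Circuit

/-! ### The fast-forwardable network -/

/-- The time-dependent network in diagonal form, `V_t = W D(t) W†` with
`D(t) = ∑_x e^{-i t E_x} |x⟩⟨x|`. -/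
def diagonalNetwork {n : ℕ} (W : Matrix.unitaryGroup (Basis n) ℂ) (E : Basis n → ℝ) (t : ℝ) :
    Op n :=
  (W : Op n) * Matrix.diagonal (fun x => Complex.exp (-(Complex.I * (t : ℂ) * (E x : ℂ)))) *
    (W : Op n).conjTranspose

end FastForward

end

/-! Write `A` for one exact step, `V` for one network step and `d = 2 ^ n`. The Pauli expectation
values of a random product state are orthogonal random variables, with second moment `3 ^ (-w)` for
a string of weight `w`. Replacing `3 ^ (-w)` by `1 / 3` for every `w ≥ 1` bounds the second moment
of `⟨Ψ|U†V|Ψ⟩` by the trace and the Frobenius norm of `U†V` alone. Hence, for a suitable phase `c`,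
`‖U - cV‖₂²` is at most `3d` times the expected loss of `V` on product states
(`exists_phase_schattenTwoNorm_le`). Telescoping gives `‖A^M - (cV)^M‖₂ ≤ M ‖A - cV‖₂`, and the Haar
second-moment formula turns this distance into an average fidelity, which is blind to the phase
(`averageFidelity_pow_ge`).

It remains to bound the expected loss by the training cost uniformly in the parameters, so that the
training procedure plays no role (`exists_generalization`). A grid of mesh `1 / N` on the entries of
the `K` local gates cuts the parameter set into at most `(2N+1) ^ (2·4^κ·K)` cells, on each of which
the loss varies by `O(K / N)`. A multiplicative Chernoff bound and a union bound give risk `≤ 4/3`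
cost `+ O((K (1 + log N) + log (1/δ)) / N)`. The fast rate `1 / N` is what allows `log N` to be
traded for `log K`: the risk is at most `1`, so the error terms may be truncated at `1`, and the
truncated terms are dominated by the two square roots (`min_one_complexity_le_sum`). The `4` in
front of the cost is `3 · 4/3`. -/

open MeasureTheory

noncomputable section

namespace FastForward

/-! ### Fourth moments of Haar-random states. -/

section Haar

variable {ι : Type} [Fintype ι] [DecidableEq ι]

theorem integral_haarState (i₀ : ι) {f : (ι → ℂ) → ℂ} (hf : Continuous f) :
    ∫ ψ, f ψ ∂(haarState i₀) = ∫ U : Matrix.unitaryGroup ι ℂ,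
      f ((U : Matrix ι ι ℂ).mulVec (Pi.single i₀ 1)) ∂(haarUnitary ι) :=
  integral_map (measurable_haarState_map i₀).aemeasurable hf.aestronglyMeasurable

theorem integrable_haarState (i₀ : ι) {f : (ι → ℂ) → ℂ} (hf : Continuous f) :
    Integrable f (haarState i₀) := by
  refine (integrable_map_measure hf.aestronglyMeasurable
    (measurable_haarState_map i₀).aemeasurable).2 ?_
  refine Continuous.integrable_of_hasCompactSupport ?_ (HasCompactSupport.of_compactSpace _)
  exact hf.comp (Continuous.matrix_mulVec continuous_subtype_val continuous_const)

instance : (haarUnitary ι).IsMulLeftInvariant :=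
  inferInstanceAs (Measure.haarMeasure _).IsMulLeftInvariant

theorem integral_haarState_mulVec (i₀ : ι) {f : (ι → ℂ) → ℂ} (hf : Continuous f)
    {V : Matrix ι ι ℂ} (hV : V ∈ Matrix.unitaryGroup ι ℂ) :
    ∫ ψ, f (V.mulVec ψ) ∂(haarState i₀) = ∫ ψ, f ψ ∂(haarState i₀) := by
  rw [integral_haarState i₀ hf, integral_haarState i₀ (f := fun ψ => f (V.mulVec ψ))
    (hf.comp (Continuous.matrix_mulVec continuous_const continuous_id))]
  rw [← integral_mul_left_eq_self (fun U : Matrix.unitaryGroup ι ℂ =>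
    f ((U : Matrix ι ι ℂ).mulVec (Pi.single i₀ 1))) (⟨V, hV⟩ : Matrix.unitaryGroup ι ℂ)]
  simp only [Matrix.mulVec_mulVec, Submonoid.coe_mul]

theorem ae_haarState_normalized (i₀ : ι) :
    ∀ᵐ ψ ∂(haarState i₀), star ψ ⬝ᵥ ψ = 1 := by
  rw [haarState, ae_map_iff (measurable_haarState_map i₀).aemeasurable
    (measurableSet_eq_fun (by fun_prop) (by fun_prop))]
  refine Filter.Eventually.of_forall fun U => ?_
  rw [Matrix.star_mulVec, Matrix.dotProduct_mulVec, Matrix.vecMul_vecMul,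
    ← Matrix.star_eq_conjTranspose, Matrix.mem_unitaryGroup_iff'.1 U.2]
  simp

/-- The fourth moments of a Haar-random state. -/
def haarMoment (i₀ i j k l : ι) : ℂ :=
  ∫ ψ, star (ψ i) * ψ j * ψ k * star (ψ l) ∂(haarState i₀)

theorem haarMoment_swap_inner (i₀ i j k l : ι) : haarMoment i₀ i j k l = haarMoment i₀ i k j l := by
  unfold haarMoment; congr 1; ext ψ; ring

theorem haarMoment_swap_outer (i₀ i j k l : ι) : haarMoment i₀ i j k l = haarMoment i₀ l j k i := by
  unfold haarMoment; congr 1; ext ψ; ring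

theorem haarMoment_conj (i₀ i j k l : ι) :
    haarMoment i₀ i j k l = star (haarMoment i₀ j i l k) := by
  unfold haarMoment
  rw [← starRingEnd_apply, ← integral_conj]; congr 1; ext ψ; simp; ring

/-- Multiplying coordinate `j` by the phase `I` preserves the law and multiplies the moment by `I`,
or by `-1` when `k = j`. The phase `-1` would not settle the case `k = j`. -/
theorem haarMoment_eq_zero_of_ne (i₀ : ι) {i j k l : ι} (hi : j ≠ i) (hl : j ≠ l) :
    haarMoment i₀ i j k l = 0 := by
  set D : Matrix ι ι ℂ := Matrix.diagonal (fun p => if p = j then Complex.I else 1)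
  have hD : D ∈ Matrix.unitaryGroup ι ℂ := by
    rw [Matrix.mem_unitaryGroup_iff, Matrix.star_eq_conjTranspose, Matrix.diagonal_conjTranspose,
      Matrix.diagonal_mul_diagonal, ← Matrix.diagonal_one]
    congr 1; ext p; simp only [Pi.star_apply]; split_ifs <;> simp
  have h := integral_haarState_mulVec i₀
    (f := fun ψ => star (ψ i) * ψ j * ψ k * star (ψ l)) (by fun_prop) hD
  simp only [D, Matrix.mulVec_diagonal, hi.symm, hl.symm, if_false, if_true, one_mul] at h
  by_cases hk : k = j
  · have e : ∀ ψ : ι → ℂ, star (ψ i) * (Complex.I * ψ j) *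
        ((if k = j then Complex.I else 1) * ψ k) * star (ψ l)
        = (-1) * (star (ψ i) * ψ j * ψ k * star (ψ l)) := fun ψ => by
      rw [if_pos hk]; linear_combination (star (ψ i) * ψ j * ψ k * star (ψ l)) * Complex.I_mul_I
    simp only [e] at h
    rw [integral_const_mul] at h
    change _ = haarMoment i₀ i j k l at h
    change -1 * haarMoment i₀ i j k l = _ at h
    linear_combination (-1/2) * h
  · have e : ∀ ψ : ι → ℂ, star (ψ i) * (Complex.I * ψ j) *
        ((if k = j then Complex.I else 1) * ψ k) * star (ψ l)
        = Complex.I * (star (ψ i) * ψ j * ψ k * star (ψ l)) := fun ψ => by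
      rw [if_neg hk]; ring
    simp only [e] at h
    rw [integral_const_mul] at h
    change Complex.I * haarMoment i₀ i j k l = haarMoment i₀ i j k l at h
    have h2 : (Complex.I - 1) * haarMoment i₀ i j k l = 0 := by linear_combination h
    refine (mul_eq_zero.1 h2).resolve_left fun h3 => ?_
    simpa using congrArg Complex.im h3

/-- The reflection acting by `(3/5, 4/5; 4/5, -3/5)` on the coordinates `i` and `k`. -/
def reflection (i k : ι) : Matrix ι ι ℂ :=
  1 - (2 / 5 : ℂ) • Matrix.vecMulVec (Pi.single i 1 - (2 : ℂ) • Pi.single k 1)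
    (Pi.single i 1 - (2 : ℂ) • Pi.single k 1)

theorem reflection_mem {i k : ι} (h : i ≠ k) : reflection i k ∈ Matrix.unitaryGroup ι ℂ := by
  set v : ι → ℂ := Pi.single i 1 - (2 : ℂ) • Pi.single k 1 with hv
  have hvs : star v = v := by
    simp [hv]
  have hvv : v ⬝ᵥ v = 5 := by
    simp [hv, dotProduct_sub, h, h.symm]; norm_num
  have hs : (reflection i k).conjTranspose = reflection i k := by
    simp only [reflection, ← hv, Matrix.conjTranspose_sub, Matrix.conjTranspose_smul,
      Matrix.conjTranspose_vecMulVec, hvs, Matrix.conjTranspose_one]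
    simp
  rw [Matrix.mem_unitaryGroup_iff, Matrix.star_eq_conjTranspose, hs]
  simp only [reflection, ← hv]
  have h2 : Matrix.vecMulVec v v * Matrix.vecMulVec v v = (5 : ℂ) • Matrix.vecMulVec v v := by
    rw [Matrix.vecMulVec_mul_vecMulVec, hvv, Matrix.vecMulVec_smul]
  rw [sub_mul, mul_sub, mul_sub, smul_mul_smul_comm, h2, one_mul, one_mul, mul_one, smul_smul,
    ← sub_eq_zero]
  have : (1 - (2 / 5 : ℂ) • Matrix.vecMulVec v v - ((2 / 5 : ℂ) • Matrix.vecMulVec v v -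
      (2 / 5 * (2 / 5) * 5 : ℂ) • Matrix.vecMulVec v v) - 1) =
      ((-(2/5) - 2/5 + 2/5*(2/5)*5 : ℂ)) • Matrix.vecMulVec v v := by
    module
  rw [this]; norm_num

theorem reflection_mulVec (i k : ι) (ψ : ι → ℂ) :
    (reflection i k).mulVec ψ = ψ - (2 / 5 * (ψ i - 2 * ψ k)) •
      (Pi.single i 1 - (2 : ℂ) • Pi.single k 1) := by
  rw [reflection, Matrix.sub_mulVec, Matrix.one_mulVec, Matrix.smul_mulVec,
    Matrix.vecMulVec_mulVec, op_smul_eq_smul, smul_smul]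
  simp [sub_dotProduct]

/-- The fourth moment of a linear combination of two coordinates. -/
theorem integral_linComb (i₀ : ι) {i k : ι} (h : i ≠ k) (a b : ℝ) :
    ∫ ψ, star ((a : ℂ) * ψ i + b * ψ k) * (a * ψ i + b * ψ k) * (a * ψ i + b * ψ k) *
      star (a * ψ i + b * ψ k) ∂(haarState i₀) =
    (a : ℂ) ^ 4 * haarMoment i₀ i i i i + b ^ 4 * haarMoment i₀ k k k k +
      4 * a ^ 2 * b ^ 2 * haarMoment i₀ i i k k := by
  set c : Fin 2 → ℂ := ![a, b]
  set x : Fin 2 → ι := ![i, k]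
  have e : ∀ ψ : ι → ℂ, star ((a : ℂ) * ψ i + b * ψ k) * (a * ψ i + b * ψ k) *
      (a * ψ i + b * ψ k) * star (a * ψ i + b * ψ k) = ∑ p, ∑ q, ∑ r, ∑ s,
      (c p * c q * c r * c s) * (star (ψ (x p)) * ψ (x q) * ψ (x r) * star (ψ (x s))) := by
    intro ψ
    simp [Fin.sum_univ_two, c, x]
    ring
  simp only [e]
  have h_int : ∀ p q r s, Integrable (fun ψ : ι → ℂ => (c p * c q * c r * c s) *
      (star (ψ (x p)) * ψ (x q) * ψ (x r) * star (ψ (x s)))) (haarState i₀) :=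
    fun p q r s => integrable_haarState i₀ (by fun_prop)
  have e2 : ∀ p q r s, ∫ ψ : ι → ℂ, (c p * c q * c r * c s) *
      (star (ψ (x p)) * ψ (x q) * ψ (x r) * star (ψ (x s))) ∂(haarState i₀) =
      (c p * c q * c r * c s) * haarMoment i₀ (x p) (x q) (x r) (x s) :=
    fun p q r s => integral_const_mul _ _
  rw [integral_finsetSum _ fun p _ => integrable_finsetSum _ fun q _ =>
    integrable_finsetSum _ fun r _ => integrable_finsetSum _ fun s _ => h_int p q r s]
  simp_rw [integral_finsetSum _ fun q _ => integrable_finsetSum _ fun r _ =>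
    integrable_finsetSum _ fun s _ => h_int _ q r s,
    integral_finsetSum _ fun r _ => integrable_finsetSum _ fun s _ => h_int _ _ r s,
    integral_finsetSum _ fun s _ => h_int _ _ _ s, e2]
  -- A monomial survives only if its conjugated indices match its unconjugated ones. Of the 16 terms
  -- this leaves the two pure ones and four mixed ones, all equal to `haarMoment i₀ i i k k`.
  have z : ∀ i j k l : ι, j ≠ i → j ≠ l → haarMoment i₀ i j k l = 0 :=
    fun i j k l h1 h2 => haarMoment_eq_zero_of_ne i₀ h1 h2
  have z2 : ∀ i j k l : ι, k ≠ i → k ≠ l → haarMoment i₀ i j k l = 0 :=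
    fun i j k l h1 h2 => by rw [haarMoment_swap_inner]; exact z _ _ _ _ h1 h2
  have z3 : ∀ i j k l : ι, i ≠ j → i ≠ k → haarMoment i₀ i j k l = 0 :=
    fun i j k l h1 h2 => by rw [haarMoment_conj, z _ _ _ _ h1 h2, star_zero]
  have z4 : ∀ i j k l : ι, l ≠ j → l ≠ k → haarMoment i₀ i j k l = 0 :=
    fun i j k l h1 h2 => by rw [haarMoment_swap_outer, z3 _ _ _ _ h1 h2]
  have h' := h.symm
  have w1 : haarMoment i₀ i k i k = haarMoment i₀ i i k k := haarMoment_swap_inner _ _ _ _ _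
  have w2 : haarMoment i₀ k i k i = haarMoment i₀ i i k k := haarMoment_swap_outer _ _ _ _ _
  have w3 : haarMoment i₀ k k i i = haarMoment i₀ i i k k := by rw [haarMoment_swap_outer, w1]
  simp only [Fin.sum_univ_two, c, x, Matrix.cons_val_zero, Matrix.cons_val_one]
  rw [z4 i i i k, z2 i i k i, z i k i i, z3 k i i i, z k i i k, z i k k i, z4 k k k i,
    z2 k k i k, z k i k k, z3 i k k k, w1, w2, w3]
  ring
  all_goals assumption

/-- Invariance under one rational reflection suffices. With `a`, `a'` the two pure moments and `b`
the mixed one, it reads `625 a = 81 a + 256 a' + 576 b` and `625 a' = 256 a + 81 a' + 576 b`.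
Subtracting gives `a = a'`, and then `a = 2 b`. -/
theorem haarMoment_relations (i₀ : ι) {i k : ι} (h : i ≠ k) :
    haarMoment i₀ i i i i = haarMoment i₀ k k k k ∧
      haarMoment i₀ i i i i = 2 * haarMoment i₀ i i k k := by
  have h1 := integral_haarState_mulVec i₀
    (f := fun ψ => star (ψ i) * ψ i * ψ i * star (ψ i)) (by fun_prop) (reflection_mem h)
  have h2 := integral_haarState_mulVec i₀
    (f := fun ψ => star (ψ k) * ψ k * ψ k * star (ψ k)) (by fun_prop) (reflection_mem h)
  have e1 : ∀ ψ : ι → ℂ, (reflection i k).mulVec ψ i =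
      ((3 / 5 : ℝ) : ℂ) * ψ i + ((4 / 5 : ℝ) : ℂ) * ψ k := by
    intro ψ; rw [reflection_mulVec]; simp [h]; ring
  have e2 : ∀ ψ : ι → ℂ, (reflection i k).mulVec ψ k =
      ((4 / 5 : ℝ) : ℂ) * ψ i + ((-3 / 5 : ℝ) : ℂ) * ψ k := by
    intro ψ; rw [reflection_mulVec]; simp [h.symm]; ring
  simp only [e1] at h1
  simp only [e2] at h2
  rw [integral_linComb i₀ h] at h1 h2
  change _ = haarMoment i₀ i i i i at h1
  change _ = haarMoment i₀ k k k k at h2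
  push_cast at h1 h2
  have h3 : haarMoment i₀ i i i i = haarMoment i₀ k k k k := by
    linear_combination (-625 / 800 : ℂ) * (h1 - h2)
  refine ⟨h3, ?_⟩
  linear_combination (-625 / 288 : ℂ) * h1 - (256 / 288 : ℂ) * h3

theorem haarMoment_eq (i₀ i j k l : ι) :
    haarMoment i₀ i j k l = haarMoment i₀ i₀ i₀ i₀ i₀ / 2 *
      ((if i = j then 1 else 0) * (if k = l then 1 else 0) +
        (if j = l then 1 else 0) * (if i = k then 1 else 0)) := by
  have ha : ∀ p, haarMoment i₀ p p p p = haarMoment i₀ i₀ i₀ i₀ i₀ := fun p => by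
    by_cases hp : p = i₀
    · rw [hp]
    · exact (haarMoment_relations i₀ hp).1
  have hb : ∀ p q, p ≠ q → haarMoment i₀ p p q q = haarMoment i₀ i₀ i₀ i₀ i₀ / 2 := fun p q hp => by
    rw [← ha p, (haarMoment_relations i₀ hp).2]; ring
  by_cases h1 : j = i
  · subst h1
    by_cases h2 : k = l
    · subst h2
      by_cases h3 : j = k
      · subst h3; simp [ha]; ring
      · simp [h3, hb]
    · by_cases h3 : k = j
      · subst h3
        rw [haarMoment_conj, haarMoment_swap_inner, haarMoment_eq_zero_of_ne] <;> simp [h2, Ne.symm h2]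
      · rw [haarMoment_swap_inner, haarMoment_eq_zero_of_ne i₀ h3 h2]; simp [h2, Ne.symm h3]
  · by_cases h2 : j = l
    · subst h2
      by_cases h3 : i = k
      · subst h3
        rw [haarMoment_swap_inner, hb _ _ (Ne.symm h1)]; simp [Ne.symm h1]
      · rw [haarMoment_conj, haarMoment_eq_zero_of_ne i₀ (Ne.symm h1) h3]; simp [Ne.symm h1, h3]
    · rw [haarMoment_eq_zero_of_ne i₀ h1 h2]; simp [Ne.symm h1, h2]

/-- Normalization fixes the remaining constant `b`: integrating `(∑ |ψ i|²)² = 1` gives `b (d² + d)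
= 1`, where `d` is the cardinality of `ι`. -/
theorem haarMoment_self (i₀ : ι) :
    haarMoment i₀ i₀ i₀ i₀ i₀ / 2 = 1 / ((Fintype.card ι : ℂ) * (Fintype.card ι + 1)) := by
  have h1 : ∑ i, ∑ k, haarMoment i₀ i i k k = 1 := by
    have h_int : ∀ i k, Integrable (fun ψ : ι → ℂ => star (ψ i) * ψ i * ψ k * star (ψ k))
      (haarState i₀) := fun i k => integrable_haarState i₀ (by fun_prop)
    simp only [haarMoment]
    simp_rw [← integral_finsetSum _ fun k _ => h_int _ k]
    rw [← integral_finsetSum _ fun i _ => integrable_finsetSum _ fun k _ => h_int i k]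
    rw [integral_congr_ae (g := fun _ => (1 : ℂ))]
    · simp
    · filter_upwards [ae_haarState_normalized i₀] with ψ hψ
      have : (star ψ ⬝ᵥ ψ) * (star ψ ⬝ᵥ ψ) = 1 := by rw [hψ, one_mul]
      rw [← this]
      simp only [dotProduct, Finset.sum_mul_sum, Pi.star_apply]
      exact Finset.sum_congr rfl fun i _ => Finset.sum_congr rfl fun k _ => by ring
  have hm := haarMoment_eq i₀
  generalize haarMoment i₀ i₀ i₀ i₀ i₀ / 2 = b at hm ⊢
  simp_rw [hm] at h1
  simp [← Finset.mul_sum, Finset.sum_add_distrib] at h1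
  have hd : ((Fintype.card ι : ℂ) * (Fintype.card ι + 1)) ≠ 0 := by
    have : Nonempty ι := ⟨i₀⟩
    exact_mod_cast (Nat.mul_pos Fintype.card_pos (Nat.succ_pos (Fintype.card ι))).ne'
  rw [eq_div_iff hd]; linear_combination h1

/-- The second moments of expectation values in a Haar-random state. -/
theorem integral_haarState_sandwich_mul (i₀ : ι) (A B : Matrix ι ι ℂ) :
    ∫ ψ, (star ψ ⬝ᵥ A.mulVec ψ) * star (star ψ ⬝ᵥ B.mulVec ψ) ∂(haarState i₀) =
      (A.trace * star B.trace + ∑ i, ∑ j, A i j * star (B i j)) /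
        ((Fintype.card ι : ℂ) * (Fintype.card ι + 1)) := by
  have e : ∀ ψ : ι → ℂ, (star ψ ⬝ᵥ A.mulVec ψ) * star (star ψ ⬝ᵥ B.mulVec ψ) =
      ∑ i, ∑ j, ∑ k, ∑ l, (A i j * star (B k l)) *
        (star (ψ i) * ψ j * ψ k * star (ψ l)) := by
    intro ψ
    have e0 : ∀ C : Matrix ι ι ℂ, star ψ ⬝ᵥ C.mulVec ψ =
        ∑ i, ∑ j, star (ψ i) * (C i j * ψ j) := fun C => by
      simp only [dotProduct, Matrix.mulVec, Finset.mul_sum, Pi.star_apply]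
    simp only [e0, star_sum, Finset.sum_mul_sum]
    refine Finset.sum_congr rfl fun i _ => ?_
    rw [Finset.sum_comm]
    refine Finset.sum_congr rfl fun j _ => Finset.sum_congr rfl fun k _ =>
      Finset.sum_congr rfl fun l _ => ?_
    simp only [star_mul', star_star]
    ring
  simp only [e]
  have h_int : ∀ p q r s, Integrable (fun ψ : ι → ℂ => (A p q * star (B r s)) *
      (star (ψ p) * ψ q * ψ r * star (ψ s))) (haarState i₀) :=
    fun p q r s => integrable_haarState i₀ (by fun_prop)
  have e2 : ∀ p q r s, ∫ ψ : ι → ℂ, (A p q * star (B r s)) *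
      (star (ψ p) * ψ q * ψ r * star (ψ s)) ∂(haarState i₀) =
      (A p q * star (B r s)) * haarMoment i₀ p q r s :=
    fun p q r s => integral_const_mul _ _
  rw [integral_finsetSum _ fun p _ => integrable_finsetSum _ fun q _ =>
    integrable_finsetSum _ fun r _ => integrable_finsetSum _ fun s _ => h_int p q r s]
  simp_rw [integral_finsetSum _ fun q _ => integrable_finsetSum _ fun r _ =>
    integrable_finsetSum _ fun s _ => h_int _ q r s,
    integral_finsetSum _ fun r _ => integrable_finsetSum _ fun s _ => h_int _ _ r s,
    integral_finsetSum _ fun s _ => h_int _ _ _ s, e2]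
  have hm := haarMoment_eq i₀
  rw [haarMoment_self] at hm
  simp_rw [hm]
  set c : ℂ := 1 / ((Fintype.card ι : ℂ) * (Fintype.card ι + 1)) with hc
  have e3 : ∀ p q r s, A p q * star (B r s) * (c * ((if p = q then 1 else 0) *
      (if r = s then 1 else 0) + (if q = s then 1 else 0) * (if p = r then 1 else 0))) =
      c * ((if p = q then A p q else 0) * (if r = s then star (B r s) else 0)) +
      c * (if p = r then (if q = s then A p q * star (B r s) else 0) else 0) := by
    intro p q r s; split_ifs <;> ring
  simp_rw [e3, Finset.sum_add_distrib, ← Finset.mul_sum]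
  rw [← mul_add, div_eq_mul_one_div _ (_ * _), ← hc, mul_comm c]
  congr 2
  · simp_rw [← Finset.sum_mul]
    simp [Matrix.trace]
  · refine Finset.sum_congr rfl fun p _ => Finset.sum_congr rfl fun q _ => ?_
    rw [Finset.sum_eq_single p] <;> simp +contextual [eq_comm]

theorem integral_haarState_sandwich_normSq (i₀ : ι) (A : Matrix ι ι ℂ) :
    ∫ ψ, ‖star ψ ⬝ᵥ A.mulVec ψ‖ ^ 2 ∂(haarState i₀) =
      (‖A.trace‖ ^ 2 + ∑ i, ∑ j, ‖A i j‖ ^ 2) /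
        ((Fintype.card ι : ℝ) * (Fintype.card ι + 1)) := by
  have h := integral_haarState_sandwich_mul i₀ A A
  have e : ∀ z : ℂ, z * star z = ((‖z‖ ^ 2 : ℝ) : ℂ) := fun z => by
    rw [← starRingEnd_apply, Complex.mul_conj, Complex.normSq_eq_norm_sq]
  simp_rw [e, integral_complex_ofReal] at h
  exact_mod_cast h

end Haar

/-! ### Pauli expansion and second moments over random product states. -/

/-- The Pauli matrices `1, X, Y, Z`. -/
def pauli : Fin 4 → Matrix (Fin 2) (Fin 2) ℂ :=
  ![1, !![0, 1; 1, 0], !![0, -Complex.I; Complex.I, 0], !![1, 0; 0, -1]]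

theorem pauli_complete (a b c e : Fin 2) :
    ∑ p, star (pauli p a b) * pauli p c e = if a = c ∧ b = e then 2 else 0 := by
  fin_cases a <;> fin_cases b <;> fin_cases c <;> fin_cases e <;>
    simp [pauli, Fin.sum_univ_four] <;> norm_num

/-- For `d = 2` the denominator `d (d + 1)` is `6`. The identity gives `(4 + 2) / 6 = 1`, a
traceless Pauli matrix gives `2 / 6`, and distinct ones are orthogonal. This makes the product-state
second moment diagonal in the Pauli coefficients. -/
theorem integral_pauli_mul (p q : Fin 4) :
    ∫ ψ, (star ψ ⬝ᵥ (pauli p).mulVec ψ) * star (star ψ ⬝ᵥ (pauli q).mulVec ψ)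
      ∂(haarState (0 : Fin 2)) = if p = q then (if p = 0 then 1 else 1 / 3) else 0 := by
  rw [integral_haarState_sandwich_mul]
  fin_cases p <;> fin_cases q <;>
    simp [pauli, Fin.sum_univ_two, Matrix.trace] <;> norm_num

variable {n : ℕ}

/-- Entries of the Pauli string `⨂ᵢ σ_{P i}`. -/
def pauliString (P : Fin n → Fin 4) : Op n := fun x y => ∏ i, pauli (P i) (x i) (y i)

theorem pauliString_complete (x y x' y' : Basis n) :
    ∑ P : Fin n → Fin 4, star (pauliString P x y) * pauliString P x' y' =
      if x = x' ∧ y = y' then (2 : ℂ) ^ n else 0 := by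
  simp only [pauliString, star_prod, ← Finset.prod_mul_distrib]
  have h := Finset.prod_univ_sum (κ := fun _ : Fin n => Fin 4) (fun _ => Finset.univ)
    (fun i p => star (pauli p (x i) (y i)) * pauli p (x' i) (y' i))
  rw [Fintype.piFinset_univ] at h
  rw [← h]
  simp_rw [pauli_complete]
  split_ifs with hh
  · obtain ⟨rfl, rfl⟩ := hh
    simp
  · by_contra hne
    refine hh ⟨funext fun i => ?_, funext fun i => ?_⟩ <;>
      have := Finset.prod_ne_zero_iff.1 hne i (Finset.mem_univ i) <;>
      simp only [ne_eq, ite_eq_right_iff, not_forall] at this <;>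
      tauto

/-- The coefficients of an operator in the basis of Pauli strings. -/
def pauliCoeff (A : Op n) (P : Fin n → Fin 4) : ℂ :=
  (∑ x, ∑ y, A x y * star (pauliString P x y)) / 2 ^ n

theorem pauli_expansion (A : Op n) (x y : Basis n) :
    A x y = ∑ P, pauliCoeff A P * pauliString P x y := by
  simp only [pauliCoeff, div_mul_eq_mul_div, ← Finset.sum_div, Finset.sum_mul]
  rw [Finset.sum_comm]
  simp_rw [Finset.sum_comm (s := (Finset.univ : Finset (Fin n → Fin 4))), mul_assoc,
    ← Finset.mul_sum, pauliString_complete]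
  rw [Finset.sum_eq_single x (by simp +contextual) (by simp),
    Finset.sum_eq_single y (by simp +contextual) (by simp)]
  simp

theorem pauli_parseval (A : Op n) :
    ∑ P, ‖pauliCoeff A P‖ ^ 2 = (∑ x, ∑ y, ‖A x y‖ ^ 2) / 2 ^ n := by
  have e : ∀ z : ℂ, ((‖z‖ ^ 2 : ℝ) : ℂ) = z * star z := fun z => by
    rw [← starRingEnd_apply, Complex.mul_conj, Complex.normSq_eq_norm_sq]
  have h : ((∑ P, ‖pauliCoeff A P‖ ^ 2 : ℝ) : ℂ) =
      (((∑ x, ∑ y, ‖A x y‖ ^ 2) / 2 ^ n : ℝ) : ℂ) := by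
    rw [Complex.ofReal_div]
    simp only [Complex.ofReal_sum, e]
    have e2 : ∀ P, pauliCoeff A P * star (pauliCoeff A P) =
        (∑ x, ∑ y, star (A x y) * (pauliCoeff A P * pauliString P x y)) / 2 ^ n := by
      intro P
      nth_rewrite 2 [pauliCoeff]
      simp only [star_div₀, star_sum, star_mul', star_star, star_pow, mul_div_assoc']
      congr 1
      · simp only [Finset.mul_sum]
        exact Finset.sum_congr rfl fun _ _ => Finset.sum_congr rfl fun _ _ => by ring
      · simp
    simp only [e2]
    rw [← Finset.sum_div, Finset.sum_comm]
    simp_rw [Finset.sum_comm (s := (Finset.univ : Finset (Fin n → Fin 4))), 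
      ← Finset.mul_sum, ← pauli_expansion]
    simp [mul_comm]
  exact_mod_cast h

theorem pauliCoeff_zero (A : Op n) : pauliCoeff A 0 = A.trace / 2 ^ n := by
  have h : ∀ x y : Basis n, star (pauliString 0 x y) = if x = y then 1 else 0 := by
    intro x y
    simp only [pauliString, pauli, Pi.zero_apply, Matrix.cons_val_zero]
    split_ifs with hxy
    · subst hxy; simp
    · obtain ⟨i, hi⟩ := Function.ne_iff.1 hxy
      have h1 : (1 : Matrix (Fin 2) (Fin 2) ℂ) (x i) (y i) = 0 := Matrix.one_apply_ne hi
      rw [Finset.prod_eq_zero (Finset.mem_univ i) h1, star_zero]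
  simp [pauliCoeff, h, Matrix.trace]

theorem sandwich_pauliString (P : Fin n → Fin 4) (ψ : Fin n → Fin 2 → ℂ) :
    star (productState ψ) ⬝ᵥ (pauliString P).mulVec (productState ψ) =
      ∏ i, star (ψ i) ⬝ᵥ (pauli (P i)).mulVec (ψ i) := by
  simp only [dotProduct, Matrix.mulVec, pauliString, productState, Pi.star_apply,
    Finset.mul_sum, star_prod, ← Finset.prod_mul_distrib]
  rw [Finset.prod_univ_sum, Fintype.piFinset_univ]
  refine Finset.sum_congr rfl fun x _ => ?_
  rw [Finset.prod_univ_sum, Fintype.piFinset_univ]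

theorem sandwich_eq_sum_pauli (A : Op n) (v : Vec n) :
    star v ⬝ᵥ A.mulVec v = ∑ P, pauliCoeff A P * (star v ⬝ᵥ (pauliString P).mulVec v) := by
  have h : A = ∑ P, pauliCoeff A P • pauliString P := by
    ext x y
    simp only [Matrix.sum_apply, Matrix.smul_apply, smul_eq_mul]
    exact pauli_expansion A x y
  conv_lhs => rw [h]
  simp [Matrix.sum_mulVec, dotProduct_sum, Matrix.smul_mulVec]

/-- The law of a random product state. -/
def productLaw (n : ℕ) : Measure (Fin n → Fin 2 → ℂ) :=
  Measure.pi fun _ => haarState (0 : Fin 2)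

instance : IsProbabilityMeasure (productLaw n) := by unfold productLaw; infer_instance

theorem integral_pauliString_mul (P Q : Fin n → Fin 4) :
    ∫ ψ, (∏ i, star (ψ i) ⬝ᵥ (pauli (P i)).mulVec (ψ i)) *
        star (∏ i, star (ψ i) ⬝ᵥ (pauli (Q i)).mulVec (ψ i)) ∂(productLaw n) =
      if P = Q then ∏ i, (if P i = 0 then (1 : ℂ) else 1 / 3) else 0 := by
  simp only [star_prod, ← Finset.prod_mul_distrib, productLaw]
  rw [integral_fintype_prod_eq_prod (f := fun i (φ : Fin 2 → ℂ) =>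
    (star φ ⬝ᵥ (pauli (P i)).mulVec φ) * star (star φ ⬝ᵥ (pauli (Q i)).mulVec φ))]
  simp_rw [integral_pauli_mul]
  split_ifs with h
  · subst h; simp
  · obtain ⟨i, hi⟩ := Function.ne_iff.1 h
    exact Finset.prod_eq_zero (Finset.mem_univ i) (if_neg hi)

theorem integrable_pauliString_mul (P Q : Fin n → Fin 4) :
    Integrable (fun ψ : Fin n → Fin 2 → ℂ => (∏ i, star (ψ i) ⬝ᵥ (pauli (P i)).mulVec (ψ i)) *
        star (∏ i, star (ψ i) ⬝ᵥ (pauli (Q i)).mulVec (ψ i))) (productLaw n) := by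
  simp only [star_prod, ← Finset.prod_mul_distrib, productLaw]
  refine Integrable.fintype_prod (f := fun i (φ : Fin 2 → ℂ) =>
    (star φ ⬝ᵥ (pauli (P i)).mulVec φ) * star (star φ ⬝ᵥ (pauli (Q i)).mulVec φ)) fun i => ?_
  refine integrable_haarState 0 ?_
  have (p : Fin 4) : Continuous fun φ : Fin 2 → ℂ => star φ ⬝ᵥ (pauli p).mulVec φ :=
    Continuous.dotProduct continuous_star (Continuous.matrix_mulVec continuous_const continuous_id)
  exact (this _).mul (this _).star

theorem integral_product_sandwich (A : Op n) :
    ∫ ψ, ‖star (productState ψ) ⬝ᵥ A.mulVec (productState ψ)‖ ^ 2 ∂(productLaw n) =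
      ∑ P, ‖pauliCoeff A P‖ ^ 2 * ∏ i, (if P i = 0 then (1 : ℝ) else 1 / 3) := by
  have e : ∀ z : ℂ, ((‖z‖ ^ 2 : ℝ) : ℂ) = z * star z := fun z => by
    rw [← starRingEnd_apply, Complex.mul_conj, Complex.normSq_eq_norm_sq]
  have e2 : ∀ ψ : Fin n → Fin 2 → ℂ,
      ((‖star (productState ψ) ⬝ᵥ A.mulVec (productState ψ)‖ ^ 2 : ℝ) : ℂ) =
      ∑ P, ∑ Q, (pauliCoeff A P * star (pauliCoeff A Q)) *
        ((∏ i, star (ψ i) ⬝ᵥ (pauli (P i)).mulVec (ψ i)) *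
        star (∏ i, star (ψ i) ⬝ᵥ (pauli (Q i)).mulVec (ψ i))) := by
    intro ψ
    rw [e, sandwich_eq_sum_pauli, star_sum, Finset.sum_mul_sum]
    refine Finset.sum_congr rfl fun P _ => Finset.sum_congr rfl fun Q _ => ?_
    rw [sandwich_pauliString, sandwich_pauliString, star_mul']
    ring
  have h : ((∫ ψ, ‖star (productState ψ) ⬝ᵥ A.mulVec (productState ψ)‖ ^ 2
      ∂(productLaw n) : ℝ) : ℂ) = ((∑ P, ‖pauliCoeff A P‖ ^ 2 *
      ∏ i, (if P i = 0 then (1 : ℝ) else 1 / 3) : ℝ) : ℂ) := by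
    rw [← integral_complex_ofReal]
    simp only [e2]
    rw [integral_finsetSum _ fun P _ => integrable_finsetSum _ fun Q _ =>
      (integrable_pauliString_mul P Q).const_mul _]
    simp_rw [integral_finsetSum _ fun Q _ =>
      (integrable_pauliString_mul _ Q).const_mul _, integral_const_mul, integral_pauliString_mul]
    rw [Complex.ofReal_sum]
    refine Finset.sum_congr rfl fun P _ => ?_
    rw [Finset.sum_eq_single P (by simp +contextual [eq_comm]) (by simp), Complex.ofReal_mul, e,
      Complex.ofReal_prod, if_pos rfl]
    congr 2
    ext i
    split_ifs <;> simp
  exact_mod_cast h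

/-- A nonzero string has at least one factor `1 / 3`, so its weight is at most `1 / 3`. The zero
string has weight `1 = 2/3 + 1/3`, and its coefficient is the normalized trace. -/
theorem integral_product_sandwich_le (A : Op n) :
    ∫ ψ, ‖star (productState ψ) ⬝ᵥ A.mulVec (productState ψ)‖ ^ 2 ∂(productLaw n) ≤
      2 / 3 * (‖A.trace‖ / 2 ^ n) ^ 2 + 1 / 3 * ((∑ x, ∑ y, ‖A x y‖ ^ 2) / 2 ^ n) := by
  rw [integral_product_sandwich, ← pauli_parseval]
  have h0 : (‖A.trace‖ / 2 ^ n) ^ 2 = ‖pauliCoeff A 0‖ ^ 2 := by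
    rw [pauliCoeff_zero, norm_div, norm_pow]; simp
  rw [h0]
  have h1 : 2 / 3 * ‖pauliCoeff A 0‖ ^ 2 + 1 / 3 * ∑ P, ‖pauliCoeff A P‖ ^ 2 =
      ∑ P, ((if P = 0 then 2 / 3 * ‖pauliCoeff A P‖ ^ 2 else 0) +
        1 / 3 * ‖pauliCoeff A P‖ ^ 2) := by
    rw [Finset.sum_add_distrib, Finset.mul_sum]; simp
  rw [h1]
  refine Finset.sum_le_sum fun P _ => ?_
  split_ifs with hP
  · subst hP
    simp; linarith
  · obtain ⟨i, hi⟩ := Function.ne_iff.1 hP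
    rw [Pi.zero_apply] at hi
    have hle : ∏ i, (if P i = 0 then (1 : ℝ) else 1 / 3) ≤ 1 / 3 := by
      rw [← Finset.mul_prod_erase _ _ (Finset.mem_univ i), if_neg hi]
      refine mul_le_of_le_one_right (by norm_num) (Finset.prod_le_one ?_ ?_)
      · intro j _; split_ifs <;> norm_num
      · intro j _; split_ifs <;> norm_num
    nlinarith [sq_nonneg ‖pauliCoeff A P‖]

/-! ### Schatten distance, average fidelity and product risk. -/

/-- The squared Schatten 2-norm is the sum of the squared moduli of the entries. -/
theorem trace_conjTranspose_mul_self_re (A : Op n) :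
    (A.conjTranspose * A).trace.re = ∑ x, ∑ y, ‖A x y‖ ^ 2 := by
  simp only [Matrix.trace, Matrix.diag, Matrix.mul_apply, Matrix.conjTranspose_apply,
    Complex.re_sum]
  rw [Finset.sum_comm]
  refine Finset.sum_congr rfl fun x _ => Finset.sum_congr rfl fun y _ => ?_
  rw [← Complex.normSq_eq_norm_sq, ← starRingEnd_apply, mul_comm, Complex.mul_conj]
  simp

theorem schattenTwoNorm_sq (A : Op n) :
    schattenTwoNorm A ^ 2 = (A.conjTranspose * A).trace.re := by
  rw [schattenTwoNorm, Real.sq_sqrt]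
  rw [trace_conjTranspose_mul_self_re]; positivity

theorem schattenTwoNorm_nonneg (A : Op n) : 0 ≤ schattenTwoNorm A := Real.sqrt_nonneg _

theorem schattenTwoNorm_eq_norm (A : Op n) :
    schattenTwoNorm A = ‖WithLp.toLp 2 fun p : Basis n × Basis n => A p.1 p.2‖ := by
  rw [EuclideanSpace.norm_eq, schattenTwoNorm, trace_conjTranspose_mul_self_re,
    Fintype.sum_prod_type]

theorem schattenTwoNorm_add_le (A B : Op n) :
    schattenTwoNorm (A + B) ≤ schattenTwoNorm A + schattenTwoNorm B := by
  simp only [schattenTwoNorm_eq_norm]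
  exact norm_add_le (WithLp.toLp 2 fun p : Basis n × Basis n => A p.1 p.2)
    (WithLp.toLp 2 fun p : Basis n × Basis n => B p.1 p.2)

theorem schattenTwoNorm_unitary_mul {V : Op n} (hV : V ∈ Matrix.unitaryGroup (Basis n) ℂ)
    (A : Op n) : schattenTwoNorm (V * A) = schattenTwoNorm A := by
  rw [schattenTwoNorm, schattenTwoNorm, Matrix.conjTranspose_mul, Matrix.mul_assoc,
    ← Matrix.mul_assoc V.conjTranspose, ← Matrix.star_eq_conjTranspose V,
    Matrix.mem_unitaryGroup_iff'.1 hV, Matrix.one_mul]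

theorem schattenTwoNorm_mul_unitary {V : Op n} (hV : V ∈ Matrix.unitaryGroup (Basis n) ℂ)
    (A : Op n) : schattenTwoNorm (A * V) = schattenTwoNorm A := by
  rw [schattenTwoNorm, schattenTwoNorm, Matrix.trace_mul_comm, Matrix.conjTranspose_mul,
    Matrix.mul_assoc, ← Matrix.mul_assoc V, ← Matrix.star_eq_conjTranspose V,
    Matrix.mem_unitaryGroup_iff.1 hV, Matrix.one_mul, Matrix.trace_mul_comm]

theorem schattenTwoNorm_pow_sub_pow_le {A B : Op n} (hA : A ∈ Matrix.unitaryGroup (Basis n) ℂ)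
    (hB : B ∈ Matrix.unitaryGroup (Basis n) ℂ) (M : ℕ) :
    schattenTwoNorm (A ^ M - B ^ M) ≤ M * schattenTwoNorm (A - B) := by
  induction M with
  | zero => simp [schattenTwoNorm]
  | succ M ih =>
    have e : A ^ (M + 1) - B ^ (M + 1) = A ^ M * (A - B) + (A ^ M - B ^ M) * B := by
      rw [pow_succ, pow_succ]; noncomm_ring
    rw [e]
    refine (schattenTwoNorm_add_le _ _).trans ?_
    rw [schattenTwoNorm_unitary_mul (pow_mem hA M), schattenTwoNorm_mul_unitary hB]
    push_cast
    linarith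

theorem trace_one_re : (1 : Op n).trace.re = 2 ^ n := by
  have h : (1 : Op n).trace = ((2 ^ n : ℝ) : ℂ) := by simp [Matrix.trace_one]
  rw [h, Complex.ofReal_re]

theorem schattenTwoNorm_sub_sq {A B : Op n} (hA : A ∈ Matrix.unitaryGroup (Basis n) ℂ)
    (hB : B ∈ Matrix.unitaryGroup (Basis n) ℂ) :
    schattenTwoNorm (A - B) ^ 2 = 2 * 2 ^ n - 2 * (A.conjTranspose * B).trace.re := by
  have h1 : A.conjTranspose * A = 1 := Matrix.mem_unitaryGroup_iff'.1 hA
  have h2 : B.conjTranspose * B = 1 := Matrix.mem_unitaryGroup_iff'.1 hB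
  have h3 : (B.conjTranspose * A).trace.re = (A.conjTranspose * B).trace.re := by
    have : B.conjTranspose * A = (A.conjTranspose * B).conjTranspose := by simp
    rw [this, Matrix.trace_conjTranspose]; simp
  rw [schattenTwoNorm_sq, Matrix.conjTranspose_sub, sub_mul, mul_sub, mul_sub, h1, h2]
  simp only [Matrix.trace_sub, Complex.sub_re, h3, trace_one_re]
  ring

theorem norm_trace_le {A : Op n} (hA : A ∈ Matrix.unitaryGroup (Basis n) ℂ) :
    ‖A.trace‖ ≤ 2 ^ n := by
  refine (norm_sum_le _ _).trans ?_
  refine (Finset.sum_le_sum fun x _ => entry_norm_bound_of_unitary hA x x).trans ?_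
  simp

theorem sum_norm_sq_unitary {A : Op n} (hA : A ∈ Matrix.unitaryGroup (Basis n) ℂ) :
    ∑ x, ∑ y, ‖A x y‖ ^ 2 = 2 ^ n := by
  rw [← trace_conjTranspose_mul_self_re, ← Matrix.star_eq_conjTranspose,
    Matrix.mem_unitaryGroup_iff'.1 hA, trace_one_re]

theorem conjTranspose_mem {A : Op n} (hA : A ∈ Matrix.unitaryGroup (Basis n) ℂ) :
    A.conjTranspose ∈ Matrix.unitaryGroup (Basis n) ℂ := by
  rw [← Matrix.star_eq_conjTranspose]; exact Unitary.star_mem hA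

theorem averageFidelity_eq {A B : Op n} (hA : A ∈ Matrix.unitaryGroup (Basis n) ℂ)
    (hB : B ∈ Matrix.unitaryGroup (Basis n) ℂ) :
    averageFidelity A B = (‖(A.conjTranspose * B).trace‖ ^ 2 + 2 ^ n) / (2 ^ n * (2 ^ n + 1)) := by
  rw [averageFidelity, integral_haarState_sandwich_normSq,
    sum_norm_sq_unitary (mul_mem (conjTranspose_mem hA) hB)]
  simp

/-- With `t` the modulus and `r` the real part of the trace of `A†B`, the infidelity is `(d² - t²) /
(d (d + 1))`, and `d² - t² ≤ 2d (d - t) ≤ d (2d - 2r) = d ‖A - B‖₂²`. -/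
theorem one_sub_averageFidelity_le {A B : Op n} (hA : A ∈ Matrix.unitaryGroup (Basis n) ℂ)
    (hB : B ∈ Matrix.unitaryGroup (Basis n) ℂ) :
    1 - averageFidelity A B ≤ schattenTwoNorm (A - B) ^ 2 / (2 ^ n + 1) := by
  rw [averageFidelity_eq hA hB, schattenTwoNorm_sub_sq hA hB]
  have h1 := norm_trace_le (mul_mem (conjTranspose_mem hA) hB)
  have h2 := Complex.re_le_norm (A.conjTranspose * B).trace
  set t := ‖(A.conjTranspose * B).trace‖
  set r := (A.conjTranspose * B).trace.re
  have hd : (0 : ℝ) < 2 ^ n := by positivity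
  set d : ℝ := 2 ^ n
  have h0 : 0 ≤ t := norm_nonneg _
  have e : 1 - (t ^ 2 + d) / (d * (d + 1)) = ((d ^ 2 - t ^ 2) / d) / (d + 1) := by
    field_simp; ring
  rw [e]
  gcongr
  rw [div_le_iff₀ hd]
  nlinarith [mul_nonneg h0 (sub_nonneg.2 h1), mul_nonneg hd.le (sub_nonneg.2 h2)]

theorem exists_phase (z : ℂ) : ∃ c : ℂ, c * star c = 1 ∧ (c * z).re = ‖z‖ := by
  by_cases hz : z = 0
  · exact ⟨1, by simp, by simp [hz]⟩
  · have hz' : (‖z‖ : ℂ) ≠ 0 := by simpa using hz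
    have hm : z * star z = (‖z‖ : ℂ) ^ 2 := by
      rw [← starRingEnd_apply, Complex.mul_conj, Complex.normSq_eq_norm_sq]; simp
    refine ⟨star z / ‖z‖, ?_, ?_⟩
    · rw [star_div₀, star_star]
      simp only [Complex.star_def, Complex.conj_ofReal]
      simp only [Complex.star_def] at hm
      field_simp
      linear_combination hm
    · rw [div_mul_eq_mul_div, mul_comm, hm, sq, mul_div_assoc, div_self hz', mul_one,
        Complex.ofReal_re]

theorem smul_mem_unitaryGroup {c : ℂ} (hc : c * star c = 1) {A : Op n}
    (hA : A ∈ Matrix.unitaryGroup (Basis n) ℂ) : c • A ∈ Matrix.unitaryGroup (Basis n) ℂ := by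
  rw [Matrix.mem_unitaryGroup_iff] at hA ⊢
  rw [star_smul, smul_mul_smul_comm, hA, hc, one_smul]

/-- The expected global loss over random product states. -/
def productRisk (U V : Op n) : ℝ :=
  1 - ∫ ψ, ‖star (productState ψ) ⬝ᵥ (U.conjTranspose * V).mulVec (productState ψ)‖ ^ 2
    ∂(productLaw n)

/-- Up to a global phase, the distance of two unitaries is controlled by the product risk. -/
theorem exists_phase_schattenTwoNorm_le {U V : Op n} (hU : U ∈ Matrix.unitaryGroup (Basis n) ℂ)
    (hV : V ∈ Matrix.unitaryGroup (Basis n) ℂ) :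
    ∃ c : ℂ, c * star c = 1 ∧
      schattenTwoNorm (U - c • V) ^ 2 ≤ 3 * 2 ^ n * productRisk U V := by
  obtain ⟨c, hc, hct⟩ := exists_phase (U.conjTranspose * V).trace
  refine ⟨c, hc, ?_⟩
  have hUV := mul_mem (conjTranspose_mem hU) hV
  have h1 := integral_product_sandwich_le (U.conjTranspose * V)
  rw [sum_norm_sq_unitary hUV] at h1
  rw [schattenTwoNorm_sub_sq hU (smul_mem_unitaryGroup hc hV), Matrix.mul_smul,
    Matrix.trace_smul, smul_eq_mul, hct]
  unfold productRisk
  have h2 := norm_trace_le hUV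
  set t := ‖(U.conjTranspose * V).trace‖
  have h0 : 0 ≤ t := norm_nonneg _
  have hd : (0 : ℝ) < 2 ^ n := by positivity
  set d : ℝ := 2 ^ n
  rw [div_self hd.ne'] at h1
  -- The right side equals `2 (d - t) (1 + t / d)`, so the factor `3` just cancels the `2 / 3` of
  -- the second-moment bound.
  have h3 : 2 * d - 2 * t ≤ 3 * d * (1 - (2 / 3 * (t / d) ^ 2 + 1 / 3 * 1)) := by
    have e : 3 * d * (1 - (2 / 3 * (t / d) ^ 2 + 1 / 3 * 1)) = 2 * (d ^ 2 - t ^ 2) / d := by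
      field_simp; ring
    rw [e, le_div_iff₀ hd]
    nlinarith [mul_nonneg h0 (sub_nonneg.2 h2)]
  refine h3.trans ?_
  gcongr

theorem diagonalNetwork_mem (W : Matrix.unitaryGroup (Basis n) ℂ) (E : Basis n → ℝ) (t : ℝ) :
    diagonalNetwork W E t ∈ Matrix.unitaryGroup (Basis n) ℂ := by
  refine mul_mem (mul_mem W.2 ?_) (conjTranspose_mem W.2)
  rw [Matrix.mem_unitaryGroup_iff, Matrix.star_eq_conjTranspose, Matrix.diagonal_conjTranspose,
    Matrix.diagonal_mul_diagonal, ← Matrix.diagonal_one]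
  congr 1; ext x
  rw [Pi.star_apply, Complex.star_def, ← Complex.exp_conj, ← Complex.exp_add]
  simp

theorem diagonalNetwork_nat_mul (W : Matrix.unitaryGroup (Basis n) ℂ) (E : Basis n → ℝ) (t : ℝ)
    (M : ℕ) : diagonalNetwork W E (M * t) = diagonalNetwork W E t ^ M := by
  have hW : (W : Op n).conjTranspose * (W : Op n) = 1 := Matrix.mem_unitaryGroup_iff'.1 W.2
  have hW' : (W : Op n) * (W : Op n).conjTranspose = 1 := Matrix.mem_unitaryGroup_iff.1 W.2
  have h : ∀ D : Op n, ((W : Op n) * D * (W : Op n).conjTranspose) ^ M =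
      (W : Op n) * D ^ M * (W : Op n).conjTranspose := by
    intro D
    induction M with
    | zero => simp [hW']
    | succ M ih =>
      rw [pow_succ, ih, pow_succ]
      simp only [Matrix.mul_assoc]
      rw [← Matrix.mul_assoc _ (W : Op n), hW, Matrix.one_mul]
  rw [diagonalNetwork, diagonalNetwork, h, Matrix.diagonal_pow]
  congr 3
  ext x
  rw [Pi.pow_apply, ← Complex.exp_nat_mul]
  congr 1
  push_cast; ring

theorem evolution_nat_mul (H : Op n) (t : ℝ) (M : ℕ) :
    evolution H (M * t) = evolution H t ^ M := by
  rw [evolution, evolution, ← Matrix.exp_nsmul]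
  congr 1
  rw [← Nat.cast_smul_eq_nsmul ℂ, smul_smul]
  congr 1
  push_cast; ring

theorem evolution_mem {H : Op n} (hH : H.IsHermitian) (t : ℝ) :
    evolution H t ∈ Matrix.unitaryGroup (Basis n) ℂ := by
  rw [Matrix.mem_unitaryGroup_iff, Matrix.star_eq_conjTranspose, evolution,
    ← Matrix.exp_conjTranspose, Matrix.conjTranspose_smul, hH.eq]
  have : star (-(Complex.I * (t : ℂ))) • H = -((-(Complex.I * (t : ℂ))) • H) := by
    simp
  rw [this, ← Matrix.exp_add_of_commute _ _ (Commute.refl ((-(Complex.I * (t : ℂ))) • H)).neg_right,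
    add_neg_cancel, NormedSpace.exp_zero]

/-- The simulation error in terms of the one-step error and of the product risk. -/
theorem averageFidelity_pow_ge {A U V : Op n} (hA : A ∈ Matrix.unitaryGroup (Basis n) ℂ)
    (hU : U ∈ Matrix.unitaryGroup (Basis n) ℂ) (hV : V ∈ Matrix.unitaryGroup (Basis n) ℂ) (M : ℕ) :
    1 - 2 * (M : ℝ) ^ 2 * (schattenTwoNorm (U - A) ^ 2 / (2 ^ n + 1) + 3 * productRisk U V) ≤
      averageFidelity (A ^ M) (V ^ M) := by
  obtain ⟨c, hc, hle⟩ := exists_phase_schattenTwoNorm_le hU hV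
  have hcV := smul_mem_unitaryGroup hc hV
  -- The fidelity depends only on the modulus of a trace, so the phase can be inserted freely.
  have e : averageFidelity (A ^ M) (V ^ M) = averageFidelity (A ^ M) ((c • V) ^ M) := by
    rw [averageFidelity_eq (pow_mem hA M) (pow_mem hV M),
      averageFidelity_eq (pow_mem hA M) (pow_mem hcV M), smul_pow, Matrix.mul_smul,
      Matrix.trace_smul, norm_smul]
    have : ‖c‖ = 1 := by
      have h := congrArg norm hc
      rw [norm_mul, norm_star, norm_one] at h
      nlinarith [norm_nonneg c]
    simp [this]
  rw [e]
  have h1 := one_sub_averageFidelity_le (pow_mem hA M) (pow_mem hcV M)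
  have h2 := schattenTwoNorm_pow_sub_pow_le hA hcV M
  have h3 : schattenTwoNorm (A - c • V) ≤ schattenTwoNorm (U - A) + schattenTwoNorm (U - c • V) := by
    have e2 : A - c • V = -(U - A) + (U - c • V) := by abel
    have e3 : schattenTwoNorm (-(U - A)) = schattenTwoNorm (U - A) := by
      rw [schattenTwoNorm, Matrix.conjTranspose_neg, neg_mul_neg, schattenTwoNorm]
    rw [e2, ← e3]
    exact schattenTwoNorm_add_le _ _
  have hn1 := schattenTwoNorm_nonneg (A ^ M - (c • V) ^ M)
  have hn2 := schattenTwoNorm_nonneg (A - c • V)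
  set p := schattenTwoNorm (U - A)
  set q := schattenTwoNorm (U - c • V)
  set r := productRisk U V
  have hd : (0 : ℝ) < 2 ^ n := by positivity
  set d : ℝ := 2 ^ n
  have h4 : schattenTwoNorm (A ^ M - (c • V) ^ M) ^ 2 ≤
      (M : ℝ) ^ 2 * (2 * p ^ 2 + 2 * (3 * d * r)) := by
    calc _ ≤ ((M : ℝ) * schattenTwoNorm (A - c • V)) ^ 2 := by gcongr
      _ = (M : ℝ) ^ 2 * schattenTwoNorm (A - c • V) ^ 2 := by ring
      _ ≤ (M : ℝ) ^ 2 * (p + q) ^ 2 := by gcongr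
      _ ≤ _ := by
        gcongr
        nlinarith [sq_nonneg (p - q)]
  have hr : 0 ≤ r := by
    have : 0 ≤ 3 * d * r := (sq_nonneg _).trans hle
    exact nonneg_of_mul_nonneg_right this (by positivity)
  -- Here `d / (d + 1)` is replaced by `1` in the risk term, which needs `r ≥ 0`.
  have h5 : (M : ℝ) ^ 2 * (2 * p ^ 2 + 2 * (3 * d * r)) / (d + 1) ≤
      2 * (M : ℝ) ^ 2 * (p ^ 2 / (d + 1) + 3 * r) := by
    have e5 : 2 * (M : ℝ) ^ 2 * (p ^ 2 / (d + 1) + 3 * r) -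
        (M : ℝ) ^ 2 * (2 * p ^ 2 + 2 * (3 * d * r)) / (d + 1) =
        (M : ℝ) ^ 2 * (6 * r) / (d + 1) := by
      field_simp; ring
    have : 0 ≤ (M : ℝ) ^ 2 * (6 * r) / (d + 1) := by positivity
    linarith
  have h6 := div_le_div_of_nonneg_right h4 (by positivity : (0 : ℝ) ≤ d + 1)
  linarith

/-! ### Finite partitions of the parameter set by gridding the local gates. -/

section Net

open scoped Matrix.Norms.L2Operator Kronecker

theorem extend_eq_submatrix (S : Finset (Fin n)) (g : Matrix (S → Fin 2) (S → Fin 2) ℂ) :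
    extend S g = (g ⊗ₖ (1 : Matrix ({i // i ∉ S} → Fin 2) ({i // i ∉ S} → Fin 2) ℂ)).submatrix
      (Equiv.piEquivPiSubtypeProd (· ∈ S) fun _ => Fin 2)
      (Equiv.piEquivPiSubtypeProd (· ∈ S) fun _ => Fin 2) := by
  ext x y
  simp [extend, Matrix.one_apply, funext_iff]

/-- `extend` as a homomorphism of star algebras. -/
def extendHom (S : Finset (Fin n)) : Matrix (S → Fin 2) (S → Fin 2) ℂ →⋆ₐ[ℂ] Op n where
  toFun := extend S
  map_one' := by
    rw [extend_eq_submatrix, Matrix.one_kronecker_one, Matrix.submatrix_one_equiv]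
  map_mul' g h := by
    simp only [extend_eq_submatrix]
    rw [Matrix.submatrix_mul_equiv, ← Matrix.mul_kronecker_mul, Matrix.one_mul]
  map_zero' := by ext x y; simp [extend]
  map_add' g h := by ext x y; simp only [extend, Matrix.add_apply]; split_ifs <;> simp
  commutes' c := by
    rw [Algebra.algebraMap_eq_smul_one, Algebra.algebraMap_eq_smul_one, extend_eq_submatrix,
      Matrix.smul_kronecker, Matrix.one_kronecker_one, Matrix.submatrix_smul]
    simp
  map_star' g := by
    ext x y
    simp only [extend, Matrix.star_apply]
    simp only [eq_comm (a := x _)]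
    split_ifs <;> simp

theorem extend_mem (S : Finset (Fin n)) (g : Matrix.unitaryGroup (S → Fin 2) ℂ) :
    extend S (g : Matrix (S → Fin 2) (S → Fin 2) ℂ) ∈ Matrix.unitaryGroup (Basis n) ℂ :=
  Unitary.map_mem (extendHom S) g.2

/-- Star homomorphisms of C*-algebras are contractive. This keeps the resolution of the net
independent of the number of qubits. -/
theorem norm_extend_sub_le (S : Finset (Fin n)) (g h : Matrix (S → Fin 2) (S → Fin 2) ℂ) :
    ‖extend S g - extend S h‖ ≤ ‖g - h‖ := by
  have : extend S g - extend S h = extendHom S (g - h) := (map_sub (extendHom S) g h).symm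
  rw [this]
  exact NonUnitalStarAlgHom.norm_apply_le (extendHom S) (g - h)

theorem norm_single_le {ι : Type} [Fintype ι] [DecidableEq ι] (i j : ι) (c : ℂ) :
    ‖Matrix.single i j c‖ ≤ ‖c‖ := by
  have h := Matrix.l2_opNorm_conjTranspose_mul_self (Matrix.single i j c)
  rw [Matrix.conjTranspose_single, Matrix.single_mul_single_same, ← Matrix.diagonal_single,
    Matrix.l2_opNorm_diagonal, Pi.norm_single, norm_mul, norm_star] at h
  nlinarith [norm_nonneg c, norm_nonneg (Matrix.single i j c)]

theorem l2_opNorm_le_sum {ι : Type} [Fintype ι] [DecidableEq ι] (A : Matrix ι ι ℂ) :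
    ‖A‖ ≤ ∑ i, ∑ j, ‖A i j‖ := by
  conv_lhs => rw [Matrix.matrix_eq_sum_single A]
  refine (norm_sum_le _ _).trans (Finset.sum_le_sum fun i _ => ?_)
  exact (norm_sum_le _ _).trans (Finset.sum_le_sum fun j _ => norm_single_le i j _)

/-- The cell of the grid of mesh `1 / m` that contains a point of the unit disk. -/
def gridCell (m : ℕ) (z : ℂ) (hz : ‖z‖ ≤ 1) :
    Finset.Icc (-(m : ℤ)) m × Finset.Icc (-(m : ℤ)) m :=
  have key : ∀ r : ℝ, |r| ≤ 1 → ⌊r * m⌋ ∈ Finset.Icc (-(m : ℤ)) m := fun r hr => by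
    rw [abs_le] at hr
    have hm : (0 : ℝ) ≤ m := Nat.cast_nonneg m
    rw [Finset.mem_Icc]
    constructor
    · rw [Int.le_floor]; push_cast; nlinarith
    · have := Int.floor_le (r * m)
      have : ((⌊r * m⌋ : ℤ) : ℝ) ≤ ((m : ℤ) : ℝ) := by push_cast; nlinarith
      exact_mod_cast this
  (⟨⌊z.re * m⌋, key _ ((Complex.abs_re_le_norm z).trans hz)⟩,
    ⟨⌊z.im * m⌋, key _ ((Complex.abs_im_le_norm z).trans hz)⟩)

theorem norm_sub_le_of_gridCell_eq {m : ℕ} (hm : 0 < m) {z w : ℂ} (hz : ‖z‖ ≤ 1) (hw : ‖w‖ ≤ 1)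
    (h : gridCell m z hz = gridCell m w hw) : ‖z - w‖ ≤ 2 / m := by
  have hm' : (0 : ℝ) < m := by exact_mod_cast hm
  simp only [gridCell, Prod.mk.injEq, Subtype.mk.injEq] at h
  have key : ∀ r s : ℝ, ⌊r * m⌋ = ⌊s * m⌋ → |r - s| ≤ 1 / m := fun r s hrs => by
    have := Int.abs_sub_lt_one_of_floor_eq_floor hrs
    rw [← sub_mul, abs_mul, abs_of_pos hm'] at this
    rw [le_div_iff₀ hm']; exact this.le
  have h1 := key _ _ h.1
  have h2 := key _ _ h.2
  have h3 := Complex.norm_le_abs_re_add_abs_im (z - w)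
  rw [Complex.sub_re, Complex.sub_im] at h3
  have : (2 : ℝ) / m = 1 / m + 1 / m := by ring
  linarith

/-- A net of the unitary group: a finite partition in parts of small diameter. -/
theorem exists_gate_key (κ : ℕ) {m : ℕ} (hm : 0 < m) (S : Finset (Fin n)) (hS : S.card ≤ κ) :
    ∃ (ι : Type) (_ : Fintype ι) (key : Matrix.unitaryGroup (S → Fin 2) ℂ → ι),
      Fintype.card ι ≤ (2 * m + 1) ^ (2 * 4 ^ κ) ∧
      ∀ g h, key g = key h → ‖(g : Matrix (S → Fin 2) (S → Fin 2) ℂ) - h‖ ≤ 4 ^ κ * (2 / m) := by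
  have hm' : (0 : ℝ) < m := by exact_mod_cast hm
  have hcard : 2 ^ S.card * 2 ^ S.card ≤ 4 ^ κ := by
    rw [← mul_pow]; exact Nat.pow_le_pow_right (by norm_num) hS
  -- The key records the grid cell of each of the at most `4 ^ κ` entries. Labelling cells, instead
  -- of choosing net points, avoids rounding back to a unitary.
  refine ⟨(S → Fin 2) × (S → Fin 2) → Finset.Icc (-(m : ℤ)) m × Finset.Icc (-(m : ℤ)) m,
    inferInstance, fun g p => gridCell m (g.1 p.1 p.2) (entry_norm_bound_of_unitary g.2 _ _),
    ?_, ?_⟩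
  · simp only [Fintype.card_fun, Fintype.card_prod, Fintype.card_coe, Int.card_Icc, Fintype.card_fin]
    have e : ((m : ℤ) + 1 - -(m : ℤ)).toNat = 2 * m + 1 := by omega
    rw [e, ← sq, ← pow_mul]
    exact Nat.pow_le_pow_right (by omega) (by omega)
  · intro g h hgh
    refine (l2_opNorm_le_sum _).trans ?_
    refine (Finset.sum_le_sum fun i _ => Finset.sum_le_sum fun j _ => ?_).trans
      (?_ : ∑ _i : S → Fin 2, ∑ _j : S → Fin 2, (2 / m : ℝ) ≤ _)
    · rw [Matrix.sub_apply]
      exact norm_sub_le_of_gridCell_eq hm _ _ (congrFun hgh (i, j))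
    · simp only [Finset.sum_const, Finset.card_univ, Fintype.card_fun, Fintype.card_fin,
        Fintype.card_coe, nsmul_eq_mul, ← mul_assoc]
      gcongr
      exact_mod_cast hcard

theorem norm_eq_one_of_mem {A : Op n} (hA : A ∈ Matrix.unitaryGroup (Basis n) ℂ) : ‖A‖ = 1 :=
  CStarRing.norm_of_mem_unitary hA

theorem Layer.toOp_mem {Θ : Type u} (l : Layer n Θ) (α : Θ) :
    l.toOp α ∈ Matrix.unitaryGroup (Basis n) ℂ := by
  cases l with
  | fixed U => exact U.2
  | gate S g => exact extend_mem S (g α)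

theorem Circuit.toOp_mem {Θ : Type u} (Q : Circuit n Θ) (α : Θ) :
    Circuit.toOp Q α ∈ Matrix.unitaryGroup (Basis n) ℂ := by
  refine list_prod_mem fun A hA => ?_
  obtain ⟨l, -, rfl⟩ := List.mem_map.1 hA
  exact l.toOp_mem α

/-- Unitaries have norm `1`, so gate errors add up along the circuit. Fixed layers contribute
neither error nor cells. -/
theorem norm_mul_sub_mul_le {A B A' B' : Op n} (hA : A ∈ Matrix.unitaryGroup (Basis n) ℂ)
    (hB : B' ∈ Matrix.unitaryGroup (Basis n) ℂ) :
    ‖A * B - A' * B'‖ ≤ ‖A - A'‖ + ‖B - B'‖ := by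
  have e : A * B - A' * B' = A * (B - B') + (A - A') * B' := by noncomm_ring
  rw [e]
  refine (norm_add_le _ _).trans ?_
  have h1 := norm_mul_le A (B - B')
  have h2 := norm_mul_le (A - A') B'
  rw [norm_eq_one_of_mem hA] at h1
  rw [norm_eq_one_of_mem hB] at h2
  linarith

/-- A net of the unitaries that are implemented by a circuit of fixed architecture. -/
theorem exists_circuit_key (κ : ℕ) {m : ℕ} (hm : 0 < m) {Θ : Type u} (Q : Circuit n Θ)
    (hQ : Circuit.IsLocal κ Q) :
    ∃ (ι : Type) (_ : Fintype ι) (key : Θ → ι),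
      Fintype.card ι ≤ ((2 * m + 1) ^ (2 * 4 ^ κ)) ^ Circuit.gateCount Q ∧
      ∀ α β, key α = key β →
        ‖Circuit.toOp Q α - Circuit.toOp Q β‖ ≤ Circuit.gateCount Q * (4 ^ κ * (2 / m : ℝ)) := by
  induction Q with
  | nil => exact ⟨Unit, inferInstance, fun _ => (), by simp [Circuit.gateCount],
      by simp [Circuit.toOp, Circuit.gateCount]⟩
  | cons l Q ih =>
    obtain ⟨ι, _, key, hcard, hkey⟩ := ih fun l' hl' => hQ l' (List.mem_cons_of_mem _ hl')
    have hprod : ∀ α, Circuit.toOp (l :: Q) α = l.toOp α * Circuit.toOp Q α := fun α => by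
      simp [Circuit.toOp]
    have hcount : Circuit.gateCount (l :: Q) = l.count + Circuit.gateCount Q := by
      simp [Circuit.gateCount]
    have hstep : ∀ α β, ‖Circuit.toOp (l :: Q) α - Circuit.toOp (l :: Q) β‖ ≤
        ‖l.toOp α - l.toOp β‖ + ‖Circuit.toOp Q α - Circuit.toOp Q β‖ := fun α β => by
      rw [hprod, hprod]
      exact norm_mul_sub_mul_le (l.toOp_mem α) (Circuit.toOp_mem Q β)
    cases l with
    | fixed U =>
      refine ⟨ι, inferInstance, key, ?_, fun α β h => ?_⟩
      · rw [hcount]; simpa [Layer.count] using hcard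
      · refine (hstep α β).trans ?_
        rw [hcount]
        simpa [Layer.count, Layer.toOp] using hkey α β h
    | gate S g =>
      obtain ⟨ι', _, key', hcard', hkey'⟩ :=
        exists_gate_key κ hm S (hQ (Layer.gate S g) List.mem_cons_self)
      refine ⟨ι' × ι, inferInstance, fun α => (key' (g α), key α), ?_, fun α β h => ?_⟩
      · rw [hcount, Fintype.card_prod, Layer.count, pow_add, pow_one]
        exact Nat.mul_le_mul hcard' hcard
      · simp only [Prod.mk.injEq] at h
        refine (hstep α β).trans ?_
        rw [hcount]
        have h1 := (norm_extend_sub_le S _ _).trans (hkey' _ _ h.1)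
        have h2 := hkey α β h.2
        simp only [Layer.count, Layer.toOp]
        push_cast
        linarith

theorem norm_sandwich_le (A : Op n) {v : Vec n} (hv : star v ⬝ᵥ v = 1) :
    ‖star v ⬝ᵥ A.mulVec v‖ ≤ ‖A‖ := by
  have e : ∀ w : Vec n, star v ⬝ᵥ w = inner ℂ (WithLp.toLp 2 v) (WithLp.toLp 2 w) := fun w => by
    rw [EuclideanSpace.inner_toLp_toLp, dotProduct_comm]
  have hn : ‖WithLp.toLp 2 v‖ = 1 := by
    have h := e v
    rw [hv, inner_self_eq_norm_sq_to_K] at h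
    have h2 : ‖WithLp.toLp 2 v‖ ^ 2 = 1 := by
      have h3 := congrArg norm h
      rw [norm_pow, RCLike.norm_ofReal, abs_norm, norm_one] at h3
      exact h3.symm
    nlinarith [norm_nonneg (WithLp.toLp 2 v)]
  rw [e]
  refine (norm_inner_le_norm _ _).trans ?_
  have := Matrix.l2_opNorm_mulVec A (WithLp.toLp 2 v)
  rw [hn, mul_one] at this
  rw [hn, one_mul]
  exact this

theorem abs_sandwich_sub_le {U V V' : Op n} (hU : U ∈ Matrix.unitaryGroup (Basis n) ℂ)
    (hV : V ∈ Matrix.unitaryGroup (Basis n) ℂ) (hV' : V' ∈ Matrix.unitaryGroup (Basis n) ℂ)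
    {v : Vec n} (hv : star v ⬝ᵥ v = 1) :
    |‖star v ⬝ᵥ (U.conjTranspose * V).mulVec v‖ ^ 2 -
      ‖star v ⬝ᵥ (U.conjTranspose * V').mulVec v‖ ^ 2| ≤ 2 * ‖V - V'‖ := by
  have h1 := norm_sandwich_le (U.conjTranspose * V) hv
  have h2 := norm_sandwich_le (U.conjTranspose * V') hv
  rw [norm_eq_one_of_mem (mul_mem (conjTranspose_mem hU) hV)] at h1
  rw [norm_eq_one_of_mem (mul_mem (conjTranspose_mem hU) hV')] at h2
  have h3 := abs_norm_sub_norm_le (star v ⬝ᵥ (U.conjTranspose * V).mulVec v)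
    (star v ⬝ᵥ (U.conjTranspose * V').mulVec v)
  have h4 : ‖star v ⬝ᵥ (U.conjTranspose * V).mulVec v -
      star v ⬝ᵥ (U.conjTranspose * V').mulVec v‖ ≤ ‖V - V'‖ := by
    rw [← dotProduct_sub, ← Matrix.sub_mulVec, ← Matrix.mul_sub]
    refine (norm_sandwich_le _ hv).trans ((norm_mul_le _ _).trans ?_)
    rw [norm_eq_one_of_mem (conjTranspose_mem hU), one_mul]
  have h5 := h3.trans h4
  set a := ‖star v ⬝ᵥ (U.conjTranspose * V).mulVec v‖
  set b := ‖star v ⬝ᵥ (U.conjTranspose * V').mulVec v‖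
  have ha : 0 ≤ a := norm_nonneg _
  have hb : 0 ≤ b := norm_nonneg _
  rw [sq_sub_sq, abs_mul, abs_of_nonneg (add_nonneg ha hb)]
  exact mul_le_mul (by linarith) h5 (abs_nonneg _) (by norm_num)

theorem norm_sandwich_unitary_le_one {U V : Op n} (hU : U ∈ Matrix.unitaryGroup (Basis n) ℂ)
    (hV : V ∈ Matrix.unitaryGroup (Basis n) ℂ) {v : Vec n} (hv : star v ⬝ᵥ v = 1) :
    ‖star v ⬝ᵥ (U.conjTranspose * V).mulVec v‖ ≤ 1 :=
  (norm_sandwich_le _ hv).trans (norm_eq_one_of_mem (mul_mem (conjTranspose_mem hU) hV)).le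

/-- A net for the fidelities of the unitaries that are implemented by a circuit. -/
theorem exists_fidelity_key (κ : ℕ) {m : ℕ} (hm : 0 < m) {Θ : Type u} (Q : Circuit n Θ)
    (hQ : Circuit.IsLocal κ Q) {U : Op n} (hU : U ∈ Matrix.unitaryGroup (Basis n) ℂ) :
    ∃ (ι : Type) (_ : Fintype ι) (key : Θ → ι),
      Fintype.card ι ≤ ((2 * m + 1) ^ (2 * 4 ^ κ)) ^ Circuit.gateCount Q ∧
      ∀ α β, key α = key β → ∀ v : Vec n, star v ⬝ᵥ v = 1 →
        |‖star v ⬝ᵥ (U.conjTranspose * Circuit.toOp Q α).mulVec v‖ ^ 2 -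
          ‖star v ⬝ᵥ (U.conjTranspose * Circuit.toOp Q β).mulVec v‖ ^ 2| ≤
            Circuit.gateCount Q * (4 ^ κ * (4 / m : ℝ)) := by
  obtain ⟨ι, hι, key, hcard, hkey⟩ := exists_circuit_key κ hm Q hQ
  refine ⟨ι, hι, key, hcard, fun α β h v hv => ?_⟩
  refine (abs_sandwich_sub_le hU (Circuit.toOp_mem Q α) (Circuit.toOp_mem Q β) hv).trans ?_
  have e : Circuit.gateCount Q * (4 ^ κ * (4 / m : ℝ)) =
      2 * (Circuit.gateCount Q * (4 ^ κ * (2 / m : ℝ))) := by ring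
  rw [e]
  exact mul_le_mul_of_nonneg_left (hkey α β h) (by norm_num)

end Net

/-! ### Multiplicative Chernoff bound and union bound. -/

section Deviation

variable {X : Type*} [MeasurableSpace X] (μ : Measure X) [IsProbabilityMeasure μ]

/-- The chord of the convex exponential over `[-1/2, 0]`, with `exp (1/2) ≥ 13/8 ≥ 8/5`. The ratio
`(1/2) / (3/8) = 4/3` becomes the factor in front of the training cost. -/
theorem exp_neg_half_le {x : ℝ} (h0 : 0 ≤ x) (h1 : x ≤ 1) :
    Real.exp (-(x / 2)) ≤ 1 - 3 / 8 * x := by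
  have hc := convexOn_exp.2 (Set.mem_univ (0 : ℝ)) (Set.mem_univ (-(1 / 2) : ℝ))
    (sub_nonneg.2 h1) h0 (by ring)
  have he : Real.exp (-(1 / 2)) ≤ 5 / 8 := by
    have h := Real.quadratic_le_exp_of_nonneg (x := 1 / 2) (by norm_num)
    rw [Real.exp_neg, inv_le_comm₀ (Real.exp_pos _) (by norm_num)]
    linarith
  simp only [smul_eq_mul, mul_zero, zero_add, Real.exp_zero, mul_one] at hc
  have e : -(x / 2) = x * -(1 / 2) := by ring
  rw [e]
  nlinarith

/-- A multiplicative Chernoff bound for the lower tail. -/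
theorem lower_tail_le (N : ℕ) {f : X → ℝ} (hf : Measurable f) (h01 : ∀ᵐ x ∂μ, 0 ≤ f x ∧ f x ≤ 1)
    (L : ℝ) :
    (Measure.pi fun _ : Fin N => μ).real
      {x | 1 / 2 * ∑ j, f (x j) ≤ N * (3 / 8 * ∫ y, f y ∂μ) - L} ≤ Real.exp (-L) := by
  set R := ∫ y, f y ∂μ
  set ν := Measure.pi fun _ : Fin N => μ
  have hfi : Integrable f μ := by
    refine Integrable.of_bound hf.aestronglyMeasurable 1 ?_
    filter_upwards [h01] with x hx
    rw [Real.norm_eq_abs, abs_of_nonneg hx.1]; exact hx.2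
  have hei : Integrable (fun y => Real.exp (-(f y / 2))) μ := by
    refine Integrable.of_bound (by fun_prop) 1 ?_
    filter_upwards [h01] with x hx
    rw [Real.norm_eq_abs, abs_of_pos (Real.exp_pos _), Real.exp_le_one_iff]
    linarith [hx.1]
  have h1 : ∫ y, Real.exp (-(f y / 2)) ∂μ ≤ Real.exp (-(3 / 8 * R)) := by
    calc ∫ y, Real.exp (-(f y / 2)) ∂μ ≤ ∫ y, (1 - 3 / 8 * f y) ∂μ := by
          refine integral_mono_ae hei ((integrable_const _).sub (hfi.const_mul _)) ?_
          filter_upwards [h01] with x hx using exp_neg_half_le hx.1 hx.2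
      _ = 1 - 3 / 8 * R := by
          rw [integral_sub (integrable_const _) (hfi.const_mul _), integral_const_mul]; simp [R]
      _ ≤ _ := by linarith [Real.add_one_le_exp (-(3 / 8 * R))]
  have hprod : ∀ x : Fin N → X, Real.exp (-(1 / 2 * ∑ j, f (x j))) =
      ∏ j, Real.exp (-(f (x j) / 2)) := fun x => by
    rw [← Real.exp_sum, Finset.mul_sum, ← Finset.sum_neg_distrib]
    exact congrArg _ (Finset.sum_congr rfl fun j _ => by ring)
  have h2 : ∫ x, Real.exp (-(1 / 2 * ∑ j, f (x j))) ∂ν ≤ Real.exp (-(N * (3 / 8 * R))) := by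
    simp only [hprod]
    rw [integral_fintype_prod_eq_pow (fun y => Real.exp (-(f y / 2))), Fintype.card_fin]
    refine (pow_le_pow_left₀ (integral_nonneg fun _ => (Real.exp_pos _).le) h1 N).trans ?_
    rw [← Real.exp_nat_mul]
    exact (congrArg _ (by ring)).le
  have h_int : Integrable (fun x : Fin N → X => Real.exp (-(1 / 2 * ∑ j, f (x j)))) ν := by
    simp only [hprod]
    exact Integrable.fintype_prod (f := fun _ y => Real.exp (-(f y / 2))) fun _ => hei
  -- Markov's inequality for `exp (-(1/2) ∑ f)`.
  have h3 := mul_meas_ge_le_integral_of_nonneg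
    (Filter.Eventually.of_forall fun x => (Real.exp_pos _).le) h_int
    (Real.exp (-(N * (3 / 8 * R) - L)))
  have hset : {x : Fin N → X | 1 / 2 * ∑ j, f (x j) ≤ N * (3 / 8 * R) - L} =
      {x | Real.exp (-(N * (3 / 8 * R) - L)) ≤ Real.exp (-(1 / 2 * ∑ j, f (x j)))} := by
    ext x; simp only [Set.mem_ofPred_eq, Real.exp_le_exp, neg_le_neg_iff]
  rw [hset]
  have h4 := h3.trans h2
  rw [← le_div_iff₀' (Real.exp_pos _), ← Real.exp_sub] at h4
  exact h4.trans (congrArg _ (by ring)).le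

/-- Uniform deviation over a finite class of functions. -/
theorem exists_uniform_deviation (N : ℕ) {ι : Type} [Fintype ι] (f : ι → X → ℝ)
    (hf : ∀ k, Measurable (f k)) (h01 : ∀ k, ∀ᵐ x ∂μ, 0 ≤ f k x ∧ f k x ≤ 1)
    {m : ℝ} (hm : 0 < m) (hcard : (Fintype.card ι : ℝ) ≤ m) {δ : ℝ} (hδ : 0 < δ) :
    ∃ G : Set (Fin N → X), MeasurableSet G ∧ 1 - δ ≤ (Measure.pi fun _ : Fin N => μ).real G ∧
      ∀ x ∈ G, ∀ k, N * (3 / 8 * ∫ y, f k y ∂μ) ≤ 1 / 2 * ∑ j, f k (x j) + Real.log (m / δ) := by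
  set B : ι → Set (Fin N → X) := fun k =>
    {x | 1 / 2 * ∑ j, f k (x j) ≤ N * (3 / 8 * ∫ y, f k y ∂μ) - Real.log (m / δ)}
  have hB : MeasurableSet (⋃ k, B k) := MeasurableSet.iUnion fun k =>
    measurableSet_le (by fun_prop) measurable_const
  refine ⟨(⋃ k, B k)ᶜ, hB.compl, ?_, fun x hx k => ?_⟩
  · rw [probReal_compl_eq_one_sub hB]
    have h1 : (Measure.pi fun _ : Fin N => μ).real (⋃ k, B k) ≤ δ := by
      refine (measureReal_iUnion_fintype_le _).trans ?_
      refine (Finset.sum_le_sum fun k _ => lower_tail_le μ N (hf k) (h01 k) _).trans ?_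
      rw [Finset.sum_const, Finset.card_univ, nsmul_eq_mul, Real.exp_neg,
        Real.exp_log (by positivity), inv_div, mul_div_assoc', div_le_iff₀ hm]
      nlinarith
    linarith
  · simp only [Set.mem_compl_iff, Set.mem_iUnion, not_exists] at hx
    have := hx k
    simp only [B, Set.mem_ofPred_eq, not_le] at this
    linarith

end Deviation

/-! ### The global cost as an empirical mean of a loss in `[0, 1]`. -/

theorem globalLoss_eq (U V : Op n) (hU : U ∈ Matrix.unitaryGroup (Basis n) ℂ)
    (hV : V ∈ Matrix.unitaryGroup (Basis n) ℂ) {v : Vec n} (hv : star v ⬝ᵥ v = 1) :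
    globalLoss V v (U.mulVec v) = 1 - ‖star v ⬝ᵥ (U.conjTranspose * V).mulVec v‖ ^ 2 := by
  set w : Vec n := V.conjTranspose.mulVec (U.mulVec v) with hw
  have h1 : V.conjTranspose * ketbra (U.mulVec v) * V = ketbra w := by
    rw [ketbra, ketbra, Matrix.mul_vecMulVec, Matrix.vecMulVec_mul, ← hw]
    congr 1
    rw [hw, Matrix.star_mulVec V.conjTranspose, Matrix.conjTranspose_conjTranspose]
  have h2 : star w ⬝ᵥ w = 1 := by
    have hm : ∀ {A : Op n}, A ∈ Matrix.unitaryGroup (Basis n) ℂ → ∀ u : Vec n,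
        star (A.mulVec u) ⬝ᵥ A.mulVec u = star u ⬝ᵥ u := fun {A} hA u => by
      rw [Matrix.star_mulVec, Matrix.dotProduct_mulVec, Matrix.vecMul_vecMul,
        ← Matrix.star_eq_conjTranspose, Matrix.mem_unitaryGroup_iff'.1 hA, Matrix.vecMul_one]
    rw [hw, hm (conjTranspose_mem hV), hm hU, hv]
  have h3 : star v ⬝ᵥ (U.conjTranspose * V).mulVec v = star w ⬝ᵥ v := by
    rw [hw, Matrix.star_mulVec, Matrix.star_mulVec, Matrix.conjTranspose_conjTranspose,
      Matrix.vecMul_vecMul, Matrix.dotProduct_mulVec]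
  have h4 : star v ⬝ᵥ w = star (star w ⬝ᵥ v) := by
    rw [Matrix.star_dotProduct]
  rw [globalLoss, h1, h3, mul_sub, mul_one, Matrix.trace_sub, ketbra, ketbra,
    Matrix.vecMulVec_mul_vecMulVec, Matrix.vecMulVec_smul, Matrix.trace_smul,
    Matrix.trace_vecMulVec, Matrix.trace_vecMulVec, dotProduct_comm w, h2, dotProduct_comm w, h4,
    smul_eq_mul, ← starRingEnd_apply (star w ⬝ᵥ v), Complex.mul_conj, Complex.normSq_eq_norm_sq]
  simp only [Complex.sub_re, Complex.one_re, Complex.ofReal_re]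

theorem productState_normalized {ψ : Fin n → Fin 2 → ℂ} (h : ∀ i, star (ψ i) ⬝ᵥ ψ i = 1) :
    star (productState ψ) ⬝ᵥ productState ψ = 1 := by
  have e : star (productState ψ) ⬝ᵥ productState ψ = ∏ i, star (ψ i) ⬝ᵥ ψ i := by
    simp only [dotProduct, productState, Pi.star_apply, star_prod, ← Finset.prod_mul_distrib]
    rw [Finset.prod_univ_sum, Fintype.piFinset_univ]
  rw [e]
  exact Finset.prod_eq_one fun i _ => h i

theorem ae_productLaw_normalized :
    ∀ᵐ ψ ∂(productLaw n), ∀ i, star (ψ i) ⬝ᵥ ψ i = 1 := by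
  rw [ae_all_iff]
  intro i
  exact (measurePreserving_eval (fun _ : Fin n => haarState (0 : Fin 2)) i).quasiMeasurePreserving.ae
    (ae_haarState_normalized 0)

theorem ae_productInputLaw_normalized (N : ℕ) :
    ∀ᵐ ψ ∂(productInputLaw N n), ∀ j i, star (ψ j i) ⬝ᵥ ψ j i = 1 := by
  rw [ae_all_iff]
  intro j
  exact (measurePreserving_eval (fun _ : Fin N => productLaw n) j).quasiMeasurePreserving.ae
    ae_productLaw_normalized

/-- The loss `1 - |⟨Ψ| U† V |Ψ⟩|²` at a product state. -/
def productLoss (U V : Op n) (ψ : Fin n → Fin 2 → ℂ) : ℝ :=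
  1 - ‖star (productState ψ) ⬝ᵥ (U.conjTranspose * V).mulVec (productState ψ)‖ ^ 2

theorem measurable_productLoss (U V : Op n) : Measurable (productLoss U V) := by
  have h : Continuous fun ψ : Fin n → Fin 2 → ℂ => productState ψ := by
    unfold productState; fun_prop
  refine Continuous.measurable ?_
  unfold productLoss
  exact continuous_const.sub ((Continuous.dotProduct h.star
    (Continuous.matrix_mulVec continuous_const h)).norm.pow 2)

theorem productLoss_mem_Icc {U V : Op n} (hU : U ∈ Matrix.unitaryGroup (Basis n) ℂ)
    (hV : V ∈ Matrix.unitaryGroup (Basis n) ℂ) {ψ : Fin n → Fin 2 → ℂ}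
    (hψ : ∀ i, star (ψ i) ⬝ᵥ ψ i = 1) : 0 ≤ productLoss U V ψ ∧ productLoss U V ψ ≤ 1 := by
  have h := norm_sandwich_unitary_le_one hU hV (productState_normalized hψ)
  have h' := pow_le_one₀ (n := 2) (norm_nonneg _) h
  exact ⟨sub_nonneg.2 h', sub_le_self _ (by positivity)⟩

theorem integrable_productLoss {U V : Op n} (hU : U ∈ Matrix.unitaryGroup (Basis n) ℂ)
    (hV : V ∈ Matrix.unitaryGroup (Basis n) ℂ) : Integrable (productLoss U V) (productLaw n) := by
  refine Integrable.of_bound (measurable_productLoss U V).aestronglyMeasurable 1 ?_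
  filter_upwards [ae_productLaw_normalized] with ψ hψ
  have := productLoss_mem_Icc hU hV hψ
  rw [Real.norm_eq_abs, abs_of_nonneg this.1]; exact this.2

theorem productRisk_eq_integral {U V : Op n} (hU : U ∈ Matrix.unitaryGroup (Basis n) ℂ)
    (hV : V ∈ Matrix.unitaryGroup (Basis n) ℂ) :
    productRisk U V = ∫ ψ, productLoss U V ψ ∂(productLaw n) := by
  have hi : Integrable (fun ψ => ‖star (productState ψ) ⬝ᵥ
      (U.conjTranspose * V).mulVec (productState ψ)‖ ^ 2) (productLaw n) := by
    have := (integrable_const (1 : ℝ)).sub (integrable_productLoss hU hV)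
    simpa [productLoss, Pi.sub_def] using this
  simp only [productLoss]
  rw [integral_sub (integrable_const _) hi, productRisk]
  simp

theorem globalCost_eq {N : ℕ} {U V : Op n} (hU : U ∈ Matrix.unitaryGroup (Basis n) ℂ)
    (hV : V ∈ Matrix.unitaryGroup (Basis n) ℂ) {ψ : Fin N → Fin n → Fin 2 → ℂ}
    (hψ : ∀ j i, star (ψ j i) ⬝ᵥ ψ j i = 1) :
    globalCost (productDataset U ψ) V = (1 / (N : ℝ)) * ∑ j, productLoss U V (ψ j) := by
  rw [globalCost]
  congr 1
  exact Finset.sum_congr rfl fun j _ => globalLoss_eq U V hU hV (productState_normalized (hψ j))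

/-! ### From the fast rate with `log N` to square roots with `log K`. -/

theorem min_one_le_sqrt {x : ℝ} (hx : 0 ≤ x) : min 1 x ≤ √x := by
  rcases le_total 1 x with h | h
  · exact (min_le_left _ _).trans (by rw [Real.one_le_sqrt]; exact h)
  · refine (min_le_right _ _).trans ?_
    rw [Real.le_sqrt hx hx]
    nlinarith

/-- If `N ≤ k ℓ`, the right side exceeds `1`. Otherwise put `q = N / k ≥ ℓ` and split `log N = log k
+ log q`: then `1 + log k ≤ 2ℓ` and `log q ≤ 2√q`, and both are at most `2q √(ℓ / q)`. -/
theorem min_one_complexity_le {k N ℓ : ℝ} (hk : 0 < k) (hN : 0 < N) (hℓ : 1 ≤ ℓ)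
    (hkℓ : Real.log k ≤ ℓ) :
    min 1 (k * (1 + Real.log N) / N) ≤ 4 * √(k * ℓ / N) := by
  rcases le_total N (k * ℓ) with h | h
  · refine (min_le_left _ _).trans ?_
    have : 1 ≤ √(k * ℓ / N) := by
      rw [Real.one_le_sqrt, le_div_iff₀ hN]; linarith
    linarith
  · refine (min_le_right _ _).trans ?_
    set q := N / k with hq
    have hqpos : 0 < q := div_pos hN hk
    have hqℓ : ℓ ≤ q := by rw [hq, le_div_iff₀ hk]; linarith
    have hNq : N = k * q := by rw [hq]; field_simp
    have hlog : Real.log N = Real.log k + Real.log q := by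
      rw [hNq, Real.log_mul hk.ne' hqpos.ne']
    have e1 : k * (1 + Real.log N) / N = (1 + Real.log k + Real.log q) / q := by
      rw [hlog, hNq]; field_simp; ring
    have e2 : k * ℓ / N = ℓ / q := by rw [hNq]; field_simp
    rw [e1, e2]
    have hs : Real.log q ≤ 2 * √q := by
      have h1 := Real.log_le_self (Real.sqrt_nonneg q)
      rw [Real.log_sqrt hqpos.le] at h1
      linarith
    have hsq : √q = q * √(1 / q) := by
      rw [Real.sqrt_div zero_le_one, Real.sqrt_one]
      have := Real.sqrt_pos.2 hqpos
      field_simp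
      exact Real.sq_sqrt hqpos.le
    have h1q : √(1 / q) ≤ √(ℓ / q) := Real.sqrt_le_sqrt (by gcongr)
    have hℓq : ℓ / q ≤ √(ℓ / q) := by
      have h0 : 0 ≤ ℓ / q := by positivity
      have h1 : ℓ / q ≤ 1 := by rw [div_le_one hqpos]; exact hqℓ
      rw [Real.le_sqrt h0 h0]; nlinarith
    rw [div_le_iff₀ hqpos]
    have hℓq' : ℓ ≤ q * √(ℓ / q) := by
      rw [div_le_iff₀ hqpos] at hℓq; linarith
    have : √q ≤ q * √(ℓ / q) := by rw [hsq]; gcongr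
    linarith

/-- For `K ≥ 2` take `ℓ = 2 log K ≥ 1`. For `K = 1` the term `K log K` vanishes, and `log (1/δ) ≥
log 2` has to absorb the complexity; this is the role of `δ ≤ 1/2`. -/
theorem min_one_complexity_le_sum (K N : ℕ) (hN : 1 ≤ N) {δ : ℝ} (hδ : 0 < δ)
    (hK : K = 1 → δ ≤ 1 / 2) :
    min 1 ((K : ℝ) * (1 + Real.log N) / N) ≤
      8 * (√((K : ℝ) * Real.log K / N) + √(Real.log (1 / δ) / N)) := by
  have hN' : (0 : ℝ) < N := by exact_mod_cast hN
  have hlog2 := Real.log_two_gt_d9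
  have hs1 := Real.sqrt_nonneg ((K : ℝ) * Real.log K / N)
  have hs2 := Real.sqrt_nonneg (Real.log (1 / δ) / N)
  have key : ∀ {a b : ℝ}, a ≤ 4 * b → √(a / N) ≤ 2 * √(b / N) := fun {a b} hab => by
    have : (2 : ℝ) = √4 := by
      rw [show (4 : ℝ) = 2 ^ 2 by norm_num, Real.sqrt_sq (by norm_num)]
    rw [this, ← Real.sqrt_mul (by norm_num)]
    refine Real.sqrt_le_sqrt ?_
    rw [← mul_div_assoc]
    gcongr
  rcases Nat.lt_or_ge K 2 with h | h
  · interval_cases K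
    · simp only [Nat.cast_zero, zero_mul, zero_div]
      rw [min_eq_right zero_le_one]
      positivity
    · have h1 := min_one_complexity_le (k := 1) (ℓ := 1) one_pos hN' le_rfl (by simp)
      have h2 : Real.log 2 ≤ Real.log (1 / δ) := by
        refine Real.log_le_log two_pos ?_
        rw [le_div_iff₀ hδ]; linarith [hK rfl]
      have h3 := key (a := 1 * 1) (b := Real.log (1 / δ)) (by linarith)
      push_cast at *
      linarith
  · have hK2 : (2 : ℝ) ≤ K := by exact_mod_cast h
    have h2 : Real.log 2 ≤ Real.log K := Real.log_le_log two_pos hK2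
    have h1 := min_one_complexity_le (k := K) (N := N) (ℓ := 2 * Real.log K) (by linarith) hN'
      (by linarith) (by linarith)
    have h3 := key (a := K * (2 * Real.log K)) (b := K * Real.log K) (by nlinarith)
    linarith

/-! ### Uniform generalization from product states. -/

/-- The constant of the generalization bound. -/
def generalizationConst (κ : ℕ) : ℝ := 160 * 4 ^ κ + 3

theorem log_card_le (κ K N : ℕ) (hN : 1 ≤ N) {δ : ℝ} (hδ : 0 < δ) :
    Real.log (((((2 * N + 1) ^ (2 * 4 ^ κ)) ^ K : ℕ) : ℝ) / δ) ≤
      K * (4 ^ κ * (4 * (1 + Real.log N))) + Real.log (1 / δ) := by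
  have hN' : (1 : ℝ) ≤ N := by exact_mod_cast hN
  rw [div_eq_mul_one_div, Real.log_mul (by positivity) (by positivity)]
  push_cast
  rw [Real.log_pow, Real.log_pow]
  have h1 : Real.log (2 * N + 1) ≤ 2 * (1 + Real.log N) := by
    have h2 : Real.log (2 * N + 1) ≤ Real.log (3 * N) :=
      Real.log_le_log (by positivity) (by linarith)
    rw [Real.log_mul (by norm_num) (by positivity)] at h2
    have h3 := Real.log_le_sub_one_of_pos (x := 3) (by norm_num)
    have h4 := Real.log_nonneg hN'
    linarith
  have h5 : (K : ℝ) * (((2 * 4 ^ κ : ℕ) : ℝ) * Real.log (2 * N + 1)) ≤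
      K * (4 ^ κ * (4 * (1 + Real.log N))) := by
    push_cast
    have : (2 * 4 ^ κ : ℝ) * Real.log (2 * N + 1) ≤ 4 ^ κ * (4 * (1 + Real.log N)) := by
      have h6 : (0 : ℝ) < 4 ^ κ := by positivity
      nlinarith
    gcongr
  linarith

/-- Uniform generalization of circuits with local parameterized gates from product states. -/
theorem exists_generalization (κ K N : ℕ) {Θ : Type u} [Nonempty Θ] (Q : Circuit n Θ)
    (hQ : Circuit.IsLocal κ Q) (hQK : Circuit.gateCount Q = K) {U : Op n}
    (hU : U ∈ Matrix.unitaryGroup (Basis n) ℂ) (hN : 1 ≤ N) {δ : ℝ} (hδ : 0 < δ) (hδ1 : δ ≤ 1)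
    (hK : K = 1 → δ ≤ 1 / 2) :
    ∃ G : Set (Fin N → Fin n → Fin 2 → ℂ), MeasurableSet G ∧
      1 - δ ≤ (productInputLaw N n).real G ∧ ∀ ψ ∈ G, ∀ α,
        productRisk U (Circuit.toOp Q α) ≤
          4 / 3 * globalCost (productDataset U ψ) (Circuit.toOp Q α) +
          generalizationConst κ * (√((K : ℝ) * Real.log K / N) + √(Real.log (1 / δ) / N)) := by
  have hN' : (0 : ℝ) < N := by exact_mod_cast hN
  -- Mesh `1 / N` makes the discretization error `O(K / N)`, no larger than the statistical one.
  obtain ⟨ι, _, key, hcard, hkey⟩ := exists_fidelity_key κ hN Q hQ hU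
  rw [hQK] at hcard hkey
  set f : Θ → (Fin n → Fin 2 → ℂ) → ℝ := fun α => productLoss U (Circuit.toOp Q α)
  have hV : ∀ α, Circuit.toOp Q α ∈ Matrix.unitaryGroup (Basis n) ℂ := Circuit.toOp_mem Q
  obtain ⟨G, hG, hGp, hGd⟩ := exists_uniform_deviation (productLaw n) N
    -- One representative parameter per cell. Labels of empty cells receive a default parameter,
    -- which only adds harmless events to the union bound.
    (fun k => f (Function.invFun key k)) (fun k => measurable_productLoss _ _)
    (fun k => by
      filter_upwards [ae_productLaw_normalized] with ψ hψ using productLoss_mem_Icc hU (hV _) hψ)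
    (m := ((((2 * N + 1) ^ (2 * 4 ^ κ)) ^ K : ℕ) : ℝ)) (by positivity)
    (by exact_mod_cast hcard) hδ
  -- Under the Haar law normalization holds only almost surely, but the comparison of empirical
  -- losses needs it at every sample.
  set G₀ : Set (Fin N → Fin n → Fin 2 → ℂ) := {ψ | ∀ j i, star (ψ j i) ⬝ᵥ ψ j i = 1} with hG₀
  have hG₀m : MeasurableSet G₀ := by
    rw [hG₀]
    simp only [Set.ofPred_forall]
    refine MeasurableSet.iInter fun j => MeasurableSet.iInter fun i =>
      IsClosed.measurableSet (isClosed_eq ?_ continuous_const)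
    exact Continuous.dotProduct (by fun_prop) (by fun_prop)
  refine ⟨G ∩ G₀, hG.inter hG₀m, ?_, fun ψ hψ α => ?_⟩
  · have : (productInputLaw N n).real (G ∩ G₀) = (productInputLaw N n).real G := by
      refine measureReal_congr ?_
      exact inter_ae_eq_left_of_ae_eq_univ (ae_eq_univ.2 (ae_productInputLaw_normalized N))
    rw [this]
    exact hGp
  have hdev := hGd ψ hψ.1 (key α)
  set β := Function.invFun key (key α)
  have hβ : key β = key α := Function.invFun_eq ⟨α, rfl⟩
  set η : ℝ := K * (4 ^ κ * (4 / N : ℝ))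
  have hclose : ∀ φ : Fin n → Fin 2 → ℂ, (∀ i, star (φ i) ⬝ᵥ φ i = 1) → |f α φ - f β φ| ≤ η := by
    intro φ hφ
    have h := hkey β α hβ _ (productState_normalized hφ)
    have e : f α φ - f β φ = ‖star (productState φ) ⬝ᵥ
        (U.conjTranspose * Circuit.toOp Q β).mulVec (productState φ)‖ ^ 2 -
        ‖star (productState φ) ⬝ᵥ
          (U.conjTranspose * Circuit.toOp Q α).mulVec (productState φ)‖ ^ 2 := by
      simp only [f, productLoss]; ring
    rw [e]
    exact h
  have hrisk : ∀ γ, productRisk U (Circuit.toOp Q γ) = ∫ φ, f γ φ ∂(productLaw n) :=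
    fun γ => productRisk_eq_integral hU (hV γ)
  have hfi : ∀ γ, Integrable (f γ) (productLaw n) := fun γ => integrable_productLoss hU (hV γ)
  have h1 : ∫ φ, f α φ ∂(productLaw n) ≤ ∫ φ, f β φ ∂(productLaw n) + η := by
    have : ∫ φ, f α φ ∂(productLaw n) ≤ ∫ φ, (f β φ + η) ∂(productLaw n) := by
      refine integral_mono_ae (hfi α) ((hfi β).add (integrable_const _)) ?_
      filter_upwards [ae_productLaw_normalized] with φ hφ
      linarith [(abs_le.1 (hclose φ hφ)).2]
    rw [integral_add (hfi β) (integrable_const _)] at this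
    simpa using this
  have h1' : ∫ φ, f α φ ∂(productLaw n) ≤ 1 := by
    have : ∫ φ, f α φ ∂(productLaw n) ≤ ∫ _, (1 : ℝ) ∂(productLaw n) := by
      refine integral_mono_ae (hfi α) (integrable_const _) ?_
      filter_upwards [ae_productLaw_normalized] with φ hφ using (productLoss_mem_Icc hU (hV α) hφ).2
    simpa using this
  have hη : 0 ≤ η := by positivity
  have h2 : ∑ j, f β (ψ j) ≤ ∑ j, f α (ψ j) + N * η := by
    have : ∑ j, f β (ψ j) ≤ ∑ j, (f α (ψ j) + η) :=
      Finset.sum_le_sum fun j _ => by linarith [(abs_le.1 (hclose (ψ j) (hψ.2 j))).1]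
    rw [Finset.sum_add_distrib] at this
    simpa using this
  have h3 : 0 ≤ ∑ j, f α (ψ j) :=
    Finset.sum_nonneg fun j _ => (productLoss_mem_Icc hU (hV α) (hψ.2 j)).1
  rw [globalCost_eq hU (hV α) hψ.2, hrisk]
  change _ ≤ 4 / 3 * (1 / (N : ℝ) * ∑ j, f α (ψ j)) + _
  have h4 := log_card_le κ K N hN hδ
  set R := ∫ φ, f α φ ∂(productLaw n)
  set Rβ := ∫ φ, f β φ ∂(productLaw n)
  set T := 1 / (N : ℝ) * ∑ j, f α (ψ j) with hT
  have hTs : ∑ j, f α (ψ j) = N * T := by rw [hT]; field_simp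
  have hT0 : 0 ≤ T := by positivity
  set u := (K : ℝ) * (1 + Real.log N) / N with hu
  set w := Real.log (1 / δ) / N with hw
  have hw0 : 0 ≤ w := div_nonneg (Real.log_nonneg (by rw [le_div_iff₀ hδ]; linarith)) hN'.le
  have hNu : (K : ℝ) * (1 + Real.log N) = N * u := by rw [hu]; field_simp
  have hNw : Real.log (1 / δ) = N * w := by rw [hw]; field_simp
  have hlogN : 0 ≤ Real.log N := Real.log_nonneg (by exact_mod_cast hN)
  have hu0 : 0 ≤ u := by positivity
  set c : ℝ := 4 ^ κ with hc
  have hc1 : 1 ≤ c := one_le_pow₀ (by norm_num)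
  have hηu : η ≤ 4 * c * u := by
    have e : η = 4 * c * (K / N) := by simp only [η]; ring
    rw [e]
    have : (K : ℝ) / N ≤ u := by
      rw [hu]; gcongr; nlinarith [(Nat.cast_nonneg K : (0 : ℝ) ≤ K)]
    gcongr
  have h5 : Rβ ≤ 4 / 3 * (T + η) + 8 / 3 * (4 * c * u + w) := by
    rw [hTs] at h2
    have e : (K : ℝ) * (c * (4 * (1 + Real.log N))) = N * (4 * c * u) := by
      linear_combination 4 * c * hNu
    rw [e, hNw] at h4
    have h6 : N * (3 / 8 * Rβ) ≤ N * (1 / 2 * (T + η) + (4 * c * u + w)) := by linarith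
    have := le_of_mul_le_mul_left h6 hN'
    linarith
  -- The discretization enters as `(1 + 4/3) η ≤ 28/3 · c u`, and the cell count gives `32/3 · c u`;
  -- together they make `20 c u`.
  have h6 : R ≤ 4 / 3 * T + (20 * c * u + 3 * w) := by nlinarith
  have h7 := min_one_complexity_le_sum K N hN hδ hK
  have h8 := min_one_le_sqrt hw0
  rw [← hu, ← hw] at h7
  have hs1 := Real.sqrt_nonneg ((K : ℝ) * Real.log K / N)
  set s1 := √((K : ℝ) * Real.log K / N)
  set s2 := √w
  -- Truncation at `1` is free: if `u` or `w` exceeds `1`, the right side is at least `1 ≥ R`.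
  have h9 : R ≤ 4 / 3 * T + (20 * c * min 1 u + 3 * min 1 w) := by
    have hmu : 0 ≤ min 1 u := le_min zero_le_one hu0
    have hmw : 0 ≤ min 1 w := le_min zero_le_one hw0
    have hcmu : 0 ≤ c * min 1 u := by positivity
    rcases le_total 1 u with hu1 | hu1
    · rw [min_eq_left hu1]; linarith
    · rcases le_total 1 w with hw1 | hw1
      · rw [min_eq_left hw1]; linarith
      · rw [min_eq_right hu1, min_eq_right hw1]; exact h6
  have h10 : 20 * c * min 1 u ≤ 20 * c * (8 * (s1 + s2)) := by gcongr
  have h11 : generalizationConst κ * (s1 + s2) = 20 * c * (8 * (s1 + s2)) + 3 * (s1 + s2) := by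
    rw [generalizationConst, ← hc]; ring
  rw [h11]
  linarith

end FastForward
end

/-! ### The main theorem. -/

open FastForward in
theorem mainTheorem1 (κ : ℕ) :
    ∃ C : ℝ, 0 < C ∧
      ∀ (n K N M : ℕ) (Θ : Type u)
        -- the Hamiltonian, the time step, the approximate short-time evolution
        (H : Op n) (Δt : ℝ) (U : Op n)
        -- the network `V_t(α) = W(α) D_t(α) W(α)†`, with a circuit for `V_Δt`
        (W : Θ → Matrix.unitaryGroup (Basis n) ℂ) (E : Θ → Basis n → ℝ) (Q : Circuit n Θ)
        -- the training procedure `α_opt`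
        (train : Dataset N n → Θ) (δ : ℝ),
        H.IsHermitian →
        U ∈ Matrix.unitaryGroup (Basis n) ℂ →
        (∀ α, Circuit.toOp Q α = diagonalNetwork (W α) (E α) Δt) →
        Circuit.gateCount Q = K →
        Circuit.IsLocal κ Q →
        1 ≤ N →
        0 < δ → δ ≤ 1 →
        (K = 1 → δ ≤ 1 / 2) →
        ∃ G : Set (Fin N → Fin n → Fin 2 → ℂ),
          MeasurableSet G ∧
          1 - δ ≤ (productInputLaw N n).real G ∧
          ∀ ψ ∈ G,
            1 - 2 * (M : ℝ) ^ 2 *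
                (schattenTwoNorm (U - evolution H Δt) ^ 2 / ((2 : ℝ) ^ n + 1) +
                  4 * globalCost (productDataset U ψ)
                    (diagonalNetwork (W (train (productDataset U ψ)))
                      (E (train (productDataset U ψ))) Δt)) -
              C * ((M : ℝ) ^ 2 *
                (√((K : ℝ) * Real.log K / N) + √(Real.log (1 / δ) / N))) ≤
            averageFidelity (evolution H ((M : ℝ) * Δt))
              (diagonalNetwork (W (train (productDataset U ψ)))
                (E (train (productDataset U ψ))) ((M : ℝ) * Δt)) := by
  -- The risk enters `averageFidelity_pow_ge` with coefficient `2 M² · 3`. This gives the `6` here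
  -- and `6 · 4/3 = 2 · 4` for the cost.
  refine ⟨6 * generalizationConst κ, by unfold generalizationConst; positivity, ?_⟩
  intro n K N M Θ H Δt U W E Q train δ hH hU hQV hQK hQ hN hδ hδ1 hK
  -- Any data set, even an unphysical one, yields a parameter.
  have : Nonempty Θ := ⟨train (fun _ => (0, 0))⟩
  obtain ⟨G, hG, hGp, hGd⟩ := exists_generalization κ K N Q hQ hQK hU hN hδ hδ1 hK
  refine ⟨G, hG, hGp, fun ψ hψ => ?_⟩
  set α := train (productDataset U ψ)
  have h1 := hGd ψ hψ α
  rw [hQV α] at h1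
  have h2 := averageFidelity_pow_ge (evolution_mem hH Δt) hU (diagonalNetwork_mem (W α) (E α) Δt) M
  rw [evolution_nat_mul, diagonalNetwork_nat_mul]
  refine le_trans ?_ h2
  have hM : (0 : ℝ) ≤ (M : ℝ) ^ 2 := sq_nonneg _
  have h3 := mul_le_mul_of_nonneg_left h1 (by positivity : (0 : ℝ) ≤ 6 * (M : ℝ) ^ 2)
  linarith
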